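/- Let $n_1,n_2\ge 0$. Call a set $C\subseteq\mathbb{R}^n$ a cone if $\alpha x\in C$ whenever $x\in C$ and $\alpha>0$; let $C^\vee=\{y\in\mathbb{R}^n : y^Tx\ge 0 \text{ for all } x\in C\}$ be its dual cone, and let $\operatorname{Aut}(C)$ be the set of matrices $L\in\mathbb{R}^{n\times n}$ with $L(C)=C$. A cone $C$ is called symmetric if it is self-dual ($C^\vee=C$) and homogeneous (for any two points $x,y$ in the interior of $C$ there is $L\in\operatorname{Aut}(C)$ with $Lx=y$). Let $M(C)$ be the set of matrices $A\in\mathbb{R}^{n\times n}$ such that $C$ is an invariant set of $\dot x=Ax$, that is, every solution with $x(0)\in C$ satisfies $x(t)\in C$ for all $t\ge 0$. A real square matrix is Hurwitz if all its complex eigenvalues have negative real part. Let $C=C_1\oplus C_2\subset\mathbb{R}^{n_1}\oplus\mathbb{R}^{n_2}$, where $C_1\subset\mathbb{R}^{n_1}$ and $C_2\subset\mathbb{R}^{n_2}$ are symmetric cones, and let $A\in M(C)$ be Hurwitz. Then there exist symmetric matrices $P_1\in\operatorname{Aut}(C_1)$ and $P_2\in\operatorname{Aut}(C_2)$ such that,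 with the block diagonal matrix $P=P_1\oplus P_2$, the quadratic form $V(x)=x^TPx$ is a Lyapunov function for $\dot x=Ax$: $V(x)>0$ and $\nabla V(x)^TAx<0$ for all $x\neq 0$ (equivalently, $P$ is positive-definite and $PA+A^TP$ is negative-definite). -/

import Mathlib

open scoped Matrix

namespace ConeLyapunov

variable {ι : Type*} [Fintype ι]

/-- A set is a cone if it is stable under multiplication by positive scalars. -/
def IsCone (C : Set (ι → ℝ)) : Prop :=
  ∀ x ∈ C, ∀ a : ℝ, 0 < a → a • x ∈ C

/-- The dual cone `{y | yᵀ x ≥ 0 for all x ∈ C}` for the standard inner product. -/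
def dualCone (C : Set (ι → ℝ)) : Set (ι → ℝ) :=
  {y | ∀ x ∈ C, 0 ≤ y ⬝ᵥ x}

/-- The automorphisms of `C`: the matrices that map `C` onto `C`. -/
def coneAut (C : Set (ι → ℝ)) : Set (Matrix ι ι ℝ) :=
  {L | (fun x => L *ᵥ x) '' C = C}

/-- `C` is homogeneous: its automorphisms act transitively on its interior. -/
def IsHomogeneousCone (C : Set (ι → ℝ)) : Prop :=
  ∀ x ∈ interior C, ∀ y ∈ interior C, ∃ L ∈ coneAut C, L *ᵥ x = y

/-- A symmetric cone is a cone that is self-dual and homogeneous. (Self-duality makes it closed,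
convex, pointed and with non-empty interior.) -/
structure IsSymmetricCone (C : Set (ι → ℝ)) : Prop where
  isCone : IsCone C
  selfDual : dualCone C = C
  homogeneous : IsHomogeneousCone C

/-- `x` solves the linear system `ẋ = A x` on `[0, ∞)`. -/
def IsSolution (A : Matrix ι ι ℝ) (x : ℝ → ι → ℝ) : Prop :=
  ∀ t : ℝ, 0 ≤ t → HasDerivWithinAt x (A *ᵥ x t) (Set.Ici 0) t

/-- `M(C)`: the matrices `A` for which `C` is an invariant set of `ẋ = A x`, i.e. each
solution with `x 0 ∈ C` has `x t ∈ C` for all `t ≥ 0`. -/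
def expNonneg (C : Set (ι → ℝ)) : Set (Matrix ι ι ℝ) :=
  {A | ∀ x : ℝ → ι → ℝ, IsSolution A x → x 0 ∈ C → ∀ t : ℝ, 0 ≤ t → x t ∈ C}

/-- `A` is Hurwitz: every complex eigenvalue of `A` has negative real part. -/
def IsHurwitz [DecidableEq ι] (A : Matrix ι ι ℝ) : Prop :=
  ∀ z ∈ spectrum ℂ (A.map Complex.ofReal), z.re < 0

/-- `V` is a (strict, global) Lyapunov function for `ẋ = A x`: it is continuously differentiable,
positive definite, and its derivative `∇V(x) · A x` along the system is negative definite. -/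
structure IsLyapunovFunction (A : Matrix ι ι ℝ) (V : (ι → ℝ) → ℝ) : Prop where
  contDiff : ContDiff ℝ 1 V
  zero : V 0 = 0
  pos : ∀ x, x ≠ 0 → 0 < V x
  decrease : ∀ x, x ≠ 0 → fderiv ℝ V x (A *ᵥ x) < 0

/-- The direct sum `C₁ ⊕ C₂ ⊆ ℝ^ι ⊕ ℝ^κ`, the latter identified with `ℝ^(ι ⊕ κ)`. -/
def coneSum {ι κ : Type*} (C₁ : Set (ι → ℝ)) (C₂ : Set (κ → ℝ)) : Set (ι ⊕ κ → ℝ) :=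
  {x | (fun i => x (Sum.inl i)) ∈ C₁ ∧ (fun j => x (Sum.inr j)) ∈ C₂}

end ConeLyapunov

open ConeLyapunov

open ConeLyapunov

namespace ConeLyapunov

open Filter Topology

/-! ### Self-dual cones and their interiors. -/

section SelfDual

variable {ι : Type*} [Fintype ι] {C : Set (ι → ℝ)}

/-! Write `C` for the sum cone; it is self-dual. Invariance makes `A` cross-nonnegative, the
analogue of Metzler. Together with the Hurwitz property this gives interior points `p = -A⁻¹e` and
`q = -A⁻ᵀe` for an interior `e` (`IsCrossNonneg.exists_mulVec_eq_neg`). Suppose a positive definite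
automorphism `P` sends `p` to `q`. Then `B = A + P⁻¹AᵀP` is again cross-nonnegative, and `-Bp = e +
P⁻¹e` is interior, so a Perron–Frobenius argument makes every real eigenvalue of `B` negative
(`IsCrossNonneg.eigenvalue_neg`). These are the generalized eigenvalues of the symmetric pencil `(PA
+ AᵀP, P)`, so `PA + AᵀP` is negative definite (`IsCrossNonneg.lyapunov_inequality`).

The block form of `P` costs nothing: `p` and `q` split along the sum, and `Pᵢ ∈ Aut(Cᵢ)` with `Pᵢpᵢ
= qᵢ` is found in each summand (`exists_posDef_automorphism`). There, let `e` be an interior point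
fixed by all orthogonal automorphisms and minimise `q · ge + e · g⁻¹p` over `g ∈ Aut(Cᵢ)`. Varying
`g` to `g exp(tX)` with `X` symmetric in the Lie algebra gives `(gᵀq - g⁻¹p) · Xe = 0`. By
homogeneity `Xe` is arbitrary, so `gᵀq = g⁻¹p`, and `P = g⁻ᵀg⁻¹` works. -/

lemma isClosed_dualCone (C : Set (ι → ℝ)) : IsClosed (dualCone C) := by
  have : dualCone C = ⋂ x ∈ C, {y | 0 ≤ y ⬝ᵥ x} := by
    ext y; simp [dualCone]
  rw [this]
  refine isClosed_biInter fun x _ => isClosed_le continuous_const ?_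
  exact Continuous.dotProduct continuous_id continuous_const

lemma mem_iff_of_selfDual (hC : dualCone C = C) {y : ι → ℝ} :
    y ∈ C ↔ ∀ x ∈ C, 0 ≤ y ⬝ᵥ x := by
  conv_lhs => rw [← hC]
  rfl

lemma isClosed_of_selfDual (hC : dualCone C = C) : IsClosed C :=
  hC ▸ isClosed_dualCone C

lemma add_mem_of_selfDual (hC : dualCone C = C) {x y : ι → ℝ} (hx : x ∈ C) (hy : y ∈ C) :
    x + y ∈ C := by
  rw [mem_iff_of_selfDual hC] at *
  intro z hz
  rw [add_dotProduct]
  exact add_nonneg (hx z hz) (hy z hz)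

lemma smul_mem_of_selfDual (hC : dualCone C = C) {x : ι → ℝ} (hx : x ∈ C) {a : ℝ}
    (ha : 0 ≤ a) : a • x ∈ C := by
  rw [mem_iff_of_selfDual hC] at *
  intro z hz
  rw [smul_dotProduct]
  exact mul_nonneg ha (hx z hz)

lemma zero_mem_of_selfDual (hC : dualCone C = C) : (0 : ι → ℝ) ∈ C := by
  rw [mem_iff_of_selfDual hC]
  simp

lemma dotProduct_nonneg_of_selfDual (hC : dualCone C = C) {x y : ι → ℝ} (hx : x ∈ C)
    (hy : y ∈ C) : 0 ≤ x ⬝ᵥ y :=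
  (mem_iff_of_selfDual hC).1 hx y hy

lemma convex_of_selfDual (hC : dualCone C = C) : Convex ℝ C := fun _ hx _ hy _ _ ha hb _ =>
  add_mem_of_selfDual hC (smul_mem_of_selfDual hC hx ha) (smul_mem_of_selfDual hC hy hb)

lemma eq_zero_of_neg_mem (hC : dualCone C = C) {x : ι → ℝ} (hx : x ∈ C) (hx' : -x ∈ C) :
    x = 0 := by
  have h1 := dotProduct_nonneg_of_selfDual hC hx' hx
  have h2 := dotProduct_nonneg_of_selfDual hC hx hx
  rw [neg_dotProduct] at h1
  exact dotProduct_self_eq_zero.1 (by linarith)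

lemma eq_zero_of_forall_dotProduct_eq_zero (hC : dualCone C = C) {v : ι → ℝ}
    (h : ∀ x ∈ C, v ⬝ᵥ x = 0) : v = 0 := by
  refine eq_zero_of_neg_mem hC ?_ ?_ <;> rw [mem_iff_of_selfDual hC] <;> intro x hx
  · exact (h x hx).ge
  · rw [neg_dotProduct, h x hx, neg_zero]

lemma dotProduct_self_pos {x : ι → ℝ} (hx : x ≠ 0) : 0 < x ⬝ᵥ x := by
  refine lt_of_le_of_ne ?_ fun h => hx (dotProduct_self_eq_zero.1 h.symm)
  exact Finset.sum_nonneg fun i _ => mul_self_nonneg _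

/-- The norm on `ι → ℝ` is the sup norm, hence the dimension factor in this form of Cauchy–Schwarz.
-/
lemma abs_dotProduct_le (x y : ι → ℝ) : |x ⬝ᵥ y| ≤ Fintype.card ι * (‖x‖ * ‖y‖) := by
  calc |x ⬝ᵥ y| ≤ ∑ i, |x i * y i| := Finset.abs_sum_le_sum_abs _ _
    _ ≤ ∑ _i : ι, ‖x‖ * ‖y‖ := by
        refine Finset.sum_le_sum fun i _ => ?_
        rw [abs_mul]
        exact mul_le_mul (norm_le_pi_norm x i) (norm_le_pi_norm y i) (abs_nonneg _)
          (norm_nonneg _)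
    _ = _ := by simp

lemma norm_sq_le_dotProduct_self (x : ι → ℝ) : ‖x‖ ^ 2 ≤ x ⬝ᵥ x := by
  have h : ‖x‖ ≤ Real.sqrt (x ⬝ᵥ x) := by
    refine (pi_norm_le_iff_of_nonneg (Real.sqrt_nonneg _)).2 fun i => ?_
    refine Real.le_sqrt_of_sq_le ?_
    rw [Real.norm_eq_abs, sq_abs, sq]
    exact Finset.single_le_sum (f := fun i => x i * x i) (fun i _ => mul_self_nonneg _)
      (Finset.mem_univ i)
  have h0 : 0 ≤ x ⬝ᵥ x := Finset.sum_nonneg fun i _ => mul_self_nonneg _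
  calc ‖x‖ ^ 2 ≤ Real.sqrt (x ⬝ᵥ x) ^ 2 := pow_le_pow_left₀ (norm_nonneg _) h 2
    _ = _ := Real.sq_sqrt h0

lemma exists_mul_norm_le (hC : dualCone C = C) {x : ι → ℝ}
    (hx : ∀ y ∈ C, y ≠ 0 → 0 < y ⬝ᵥ x) : ∃ m > 0, ∀ y ∈ C, m * ‖y‖ ≤ y ⬝ᵥ x := by
  have hK : IsCompact (C ∩ Metric.sphere (0 : ι → ℝ) 1) :=
    (isCompact_sphere _ _).inter_left (isClosed_of_selfDual hC)
  have key : ∃ m > 0, ∀ y ∈ C ∩ Metric.sphere (0 : ι → ℝ) 1, m ≤ y ⬝ᵥ x := by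
    rcases (C ∩ Metric.sphere (0 : ι → ℝ) 1).eq_empty_or_nonempty with h | h
    -- The slice is empty only when `C = {0}`.
    · exact ⟨1, one_pos, by simp [h]⟩
    · obtain ⟨u, hu, hmin⟩ := hK.exists_isMinOn h
        (f := fun y => y ⬝ᵥ x) (Continuous.dotProduct continuous_id continuous_const).continuousOn
      refine ⟨u ⬝ᵥ x, hx u hu.1 ?_, fun y hy => hmin hy⟩
      rintro rfl
      simpa using hu.2
  obtain ⟨m, hm, h⟩ := key
  refine ⟨m, hm, fun y hy => ?_⟩
  by_cases h0 : y = 0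
  · simp [h0]
  have hn : 0 < ‖y‖ := norm_pos_iff.2 h0
  have := h (‖y‖⁻¹ • y) ⟨smul_mem_of_selfDual hC hy (by positivity), by
    simp [norm_smul, hn.ne']⟩
  rw [smul_dotProduct, smul_eq_mul, ← div_eq_inv_mul, le_div_iff₀ hn] at this
  exact this

/-- If `x` is interior, `x - t y ∈ C` for some `t > 0`, and pairing with `y` gives `y · x ≥ t (y ·
y)`. Conversely, compactness makes the positivity uniform, so it survives small perturbations of
`x`. -/
lemma mem_interior_iff_of_selfDual (hC : dualCone C = C) {x : ι → ℝ} :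
    x ∈ interior C ↔ ∀ y ∈ C, y ≠ 0 → 0 < y ⬝ᵥ x := by
  constructor
  · intro hx y hy hy0
    have hcont : Tendsto (fun t : ℝ => x - t • y) (𝓝[>] 0) (𝓝 x) := by
      have : Continuous fun t : ℝ => x - t • y := by fun_prop
      simpa using (this.tendsto 0).mono_left nhdsWithin_le_nhds
    obtain ⟨t, ht, ht0⟩ := ((hcont.eventually (mem_interior_iff_mem_nhds.1 hx)).and
      self_mem_nhdsWithin).exists
    have h1 := dotProduct_nonneg_of_selfDual hC hy ht
    rw [dotProduct_sub, dotProduct_smul, smul_eq_mul] at h1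
    have := mul_pos ht0 (dotProduct_self_pos hy0)
    linarith
  · intro hx
    obtain ⟨m, hm, h⟩ := exists_mul_norm_le hC hx
    rw [mem_interior_iff_mem_nhds, Metric.mem_nhds_iff]
    refine ⟨m / (Fintype.card ι + 1), by positivity, fun z hz => ?_⟩
    rw [mem_iff_of_selfDual hC]
    intro y hy
    have h1 := h y hy
    have h2 := abs_dotProduct_le y (z - x)
    rw [Metric.mem_ball, dist_eq_norm, lt_div_iff₀ (by positivity)] at hz
    have h3 : (Fintype.card ι : ℝ) * (‖y‖ * ‖z - x‖) ≤ m * ‖y‖ := by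
      have := mul_le_mul_of_nonneg_right hz.le (norm_nonneg y)
      have := mul_nonneg (norm_nonneg (z - x)) (norm_nonneg y)
      nlinarith
    have h4 := neg_abs_le (y ⬝ᵥ (z - x))
    rw [dotProduct_sub] at *
    rw [dotProduct_comm]
    linarith

/-- A functional vanishing on `C` is represented by a vector `v` with `±v ∈ C`, hence is zero. So
`C` spans, and a spanning convex set containing `0` has interior. -/
lemma interior_nonempty_of_selfDual (hC : dualCone C = C) : (interior C).Nonempty := by
  classical
  rw [(convex_of_selfDual hC).interior_nonempty_iff_affineSpan_eq_top]
  have hspan : Submodule.span ℝ C = ⊤ := by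
    by_contra hne
    obtain ⟨f, hf, hle⟩ := Submodule.exists_le_ker_of_lt_top _ (lt_top_iff_ne_top.2 hne)
    refine hf (LinearMap.pi_ext' fun i => LinearMap.ext_ring ?_)
    have hrep : ∀ x, (fun i => f (Pi.single i 1)) ⬝ᵥ x = f x := by
      intro x
      conv_rhs => rw [pi_eq_sum_univ' x]
      simp [dotProduct, map_sum, mul_comm]
    have := eq_zero_of_forall_dotProduct_eq_zero hC (v := fun i => f (Pi.single i 1))
      fun x hx => (hrep x).trans (hle (Submodule.subset_span hx))
    exact congrFun this i
  have h0 := zero_mem_of_selfDual hC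
  rw [AffineSubspace.affineSpan_eq_top_iff_vectorSpan_eq_top_of_nonempty _ _ _ ⟨0, h0⟩,
    vectorSpan_eq_span_vsub_set_right ℝ h0]
  simpa using hspan

lemma add_mem_interior_of_selfDual (hC : dualCone C = C) {x y : ι → ℝ} (hx : x ∈ interior C)
    (hy : y ∈ C) : x + y ∈ interior C := by
  rw [mem_interior_iff_of_selfDual hC] at *
  intro z hz hz0
  rw [dotProduct_add]
  exact add_pos_of_pos_of_nonneg (hx z hz hz0) (dotProduct_nonneg_of_selfDual hC hz hy)

lemma smul_mem_interior_of_selfDual (hC : dualCone C = C) {x : ι → ℝ} (hx : x ∈ interior C)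
    {a : ℝ} (ha : 0 < a) : a • x ∈ interior C := by
  rw [mem_interior_iff_of_selfDual hC] at *
  intro z hz hz0
  rw [dotProduct_smul]
  exact mul_pos ha (hx z hz hz0)

/-- A boundary point of a self-dual cone is orthogonal to a nonzero element of the cone. -/
lemma exists_dotProduct_eq_zero_of_notMem_interior (hC : dualCone C = C) {x : ι → ℝ}
    (hx : x ∈ C) (hx' : x ∉ interior C) : ∃ y ∈ C, y ≠ 0 ∧ y ⬝ᵥ x = 0 := by
  rw [mem_interior_iff_of_selfDual hC] at hx'
  push Not at hx'
  obtain ⟨y, hy, hy0, h⟩ := hx'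
  exact ⟨y, hy, hy0, le_antisymm h (dotProduct_nonneg_of_selfDual hC hy hx)⟩

end SelfDual

/-! ### Cross-nonnegative matrices: flows, resolvents, real eigenvalues. -/

section CrossNonneg

open NormedSpace
open scoped Matrix.Norms.Operator

variable {ι : Type*} [Fintype ι] {C : Set (ι → ℝ)}

/-- `A` is cross-nonnegative on the self-dual cone `C`: orthogonal `x, y ∈ C` satisfy
`yᵀ A x ≥ 0`. For the nonnegative orthant these are the Metzler matrices. -/
def IsCrossNonneg (C : Set (ι → ℝ)) (A : Matrix ι ι ℝ) : Prop :=
  ∀ x ∈ C, ∀ y ∈ C, y ⬝ᵥ x = 0 → 0 ≤ y ⬝ᵥ (A *ᵥ x)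

lemma IsCrossNonneg.transpose {A : Matrix ι ι ℝ} (hA : IsCrossNonneg C A) :
    IsCrossNonneg C Aᵀ := by
  intro x hx y hy h
  rw [Matrix.mulVec_transpose, dotProduct_comm, ← Matrix.dotProduct_mulVec]
  exact hA y hy x hx (by rwa [dotProduct_comm])

lemma IsCrossNonneg.add {A B : Matrix ι ι ℝ} (hA : IsCrossNonneg C A)
    (hB : IsCrossNonneg C B) : IsCrossNonneg C (A + B) := by
  intro x hx y hy h
  rw [Matrix.add_mulVec, dotProduct_add]
  exact add_nonneg (hA x hx y hy h) (hB x hx y hy h)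

lemma hasDerivAt_exp_smul_mulVec [DecidableEq ι] (A : Matrix ι ι ℝ) (x : ι → ℝ) (t : ℝ) :
    HasDerivAt (fun s : ℝ => exp (s • A) *ᵥ x) (A *ᵥ (exp (t • A) *ᵥ x)) t := by
  have h := hasDerivAt_exp_smul_const' (𝕂 := ℝ) A t
  let Φ : Matrix ι ι ℝ →L[ℝ] (ι → ℝ) :=
    LinearMap.toContinuousLinearMap ((Matrix.mulVecBilin ℝ ℝ).flip x)
  have h2 := Φ.hasFDerivAt.comp_hasDerivAt t h
  rw [Matrix.mulVec_mulVec]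
  exact h2

lemma hasDerivAt_dotProduct_left {u : ℝ → ι → ℝ} {u' : ι → ℝ} {t : ℝ} (y : ι → ℝ)
    (hu : HasDerivAt u u' t) : HasDerivAt (fun s => y ⬝ᵥ u s) (y ⬝ᵥ u') t := by
  rw [hasDerivAt_pi] at hu
  exact HasDerivAt.fun_sum fun i _ => (hu i).const_mul (y i)

lemma nonneg_of_hasDerivAt_of_eventually_le_nhdsGT {f : ℝ → ℝ} {f' t : ℝ} (hf : HasDerivAt f f' t)
    (h : ∀ᶠ s in 𝓝[>] t, f t ≤ f s) : 0 ≤ f' := by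
  have := (hasDerivAt_iff_tendsto_slope.1 hf).mono_left
    (nhdsWithin_mono t (s := Set.Ioi t) fun s hs => ne_of_gt hs)
  refine ge_of_tendsto this ?_
  filter_upwards [h, self_mem_nhdsWithin] with s hs hst
  rw [slope_def_field]
  exact div_nonneg (sub_nonneg.2 hs) (sub_nonneg.2 (le_of_lt hst))

lemma nonpos_of_hasDerivAt_of_eventually_le_nhdsLT {f : ℝ → ℝ} {f' t : ℝ} (hf : HasDerivAt f f' t)
    (h : ∀ᶠ s in 𝓝[<] t, f t ≤ f s) : f' ≤ 0 := by
  have := (hasDerivAt_iff_tendsto_slope.1 hf).mono_left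
    (nhdsWithin_mono t (s := Set.Iio t) fun s hs => ne_of_lt hs)
  refine le_of_tendsto this ?_
  filter_upwards [h, self_mem_nhdsWithin] with s hs hst
  rw [slope_def_field]
  exact div_nonpos_of_nonneg_of_nonpos (sub_nonneg.2 hs) (sub_nonpos.2 (le_of_lt hst))

/-- The function `t ↦ y · exp(tA)x` vanishes at `0` and is nonnegative afterwards, so its derivative
at `0` is nonnegative. -/
lemma isCrossNonneg_of_mem_expNonneg (hC : dualCone C = C) {A : Matrix ι ι ℝ}
    (hA : A ∈ expNonneg C) : IsCrossNonneg C A := by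
  classical
  intro x hx y hy h
  have hmem := hA (fun t => exp (t • A) *ᵥ x)
    (fun t _ => (hasDerivAt_exp_smul_mulVec A x t).hasDerivWithinAt) (by simpa using hx)
  have hd := hasDerivAt_dotProduct_left y (hasDerivAt_exp_smul_mulVec A x 0)
  simp only [zero_smul, exp_zero, Matrix.one_mulVec] at hd
  refine nonneg_of_hasDerivAt_of_eventually_le_nhdsGT hd ?_
  filter_upwards [self_mem_nhdsWithin] with t ht
  simpa [h] using dotProduct_nonneg_of_selfDual hC hy (hmem t (le_of_lt ht))

/-- Cross-nonnegativity only forbids pointing outwards on the boundary. Adding `δ exp(Mt) e` makes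
the field point strictly inwards, so the perturbed curve cannot have a first exit time; then `δ →
0`. -/
lemma IsCrossNonneg.exp_mulVec_mem [DecidableEq ι] (hC : dualCone C = C) {A : Matrix ι ι ℝ}
    (hA : IsCrossNonneg C A) {x : ι → ℝ} (hx : x ∈ C) {t : ℝ} (ht : 0 ≤ t) :
    exp (t • A) *ᵥ x ∈ C := by
  obtain ⟨e, he⟩ := interior_nonempty_of_selfDual hC
  obtain ⟨M, hM⟩ : ∃ M : ℝ, M • e - A *ᵥ e ∈ interior C := by
    have hcont : Tendsto (fun r : ℝ => e - r • (A *ᵥ e)) (𝓝[>] 0) (𝓝 e) := by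
      have : Continuous fun r : ℝ => e - r • (A *ᵥ e) := by fun_prop
      simpa using (this.tendsto 0).mono_left nhdsWithin_le_nhds
    obtain ⟨r, hr, hr0⟩ := ((hcont.eventually (isOpen_interior.mem_nhds he)).and
      self_mem_nhdsWithin).exists
    refine ⟨r⁻¹, ?_⟩
    have := smul_mem_interior_of_selfDual hC hr (inv_pos.2 hr0)
    rwa [smul_sub, smul_smul, inv_mul_cancel₀ (ne_of_gt hr0), one_smul] at this
  -- the perturbed solutions stay in the interior
  have key : ∀ δ : ℝ, 0 < δ → ∀ t : ℝ, 0 ≤ t →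
      exp (t • A) *ᵥ x + (δ * Real.exp (M * t)) • e ∈ interior C := by
    intro δ hδ
    set u : ℝ → ι → ℝ := fun t => exp (t • A) *ᵥ x + (δ * Real.exp (M * t)) • e with hu
    have hderiv : ∀ t, HasDerivAt u
        (A *ᵥ u t + (δ * Real.exp (M * t)) • (M • e - A *ᵥ e)) t := by
      intro t
      have h1 : HasDerivAt (fun t => δ * Real.exp (M * t)) (δ * (Real.exp (M * t) * M)) t := by
        simpa using (((hasDerivAt_id t).const_mul M).exp).const_mul δ
      have h2 := (hasDerivAt_exp_smul_mulVec A x t).add (h1.smul_const e)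
      have h3 : A *ᵥ u t + (δ * Real.exp (M * t)) • (M • e - A *ᵥ e) =
          A *ᵥ (exp (t • A) *ᵥ x) + (δ * (Real.exp (M * t) * M)) • e := by
        rw [hu, Matrix.mulVec_add, Matrix.mulVec_smul]
        module
      rw [h3]
      exact h2
    have hcont : Continuous u := continuous_iff_continuousAt.2 fun t => (hderiv t).continuousAt
    have hu0 : u 0 ∈ interior C := by
      have := add_mem_interior_of_selfDual hC (smul_mem_interior_of_selfDual hC he hδ) hx
      simpa [hu, add_comm] using this
    by_contra! hbad
    obtain ⟨t₀, ht₀, hbad⟩ := hbad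
    have hclosed : IsClosed (Set.Ici (0 : ℝ) ∩ u ⁻¹' (interior C)ᶜ) :=
      isClosed_Ici.inter (isOpen_interior.isClosed_compl.preimage hcont)
    have hbdd : BddBelow (Set.Ici (0 : ℝ) ∩ u ⁻¹' (interior C)ᶜ) := ⟨0, fun s hs => hs.1⟩
    obtain ⟨h0, hout⟩ := hclosed.csInf_mem ⟨t₀, ht₀, hbad⟩ hbdd
    have hlt : ∀ s, 0 ≤ s → s < sInf (Set.Ici (0 : ℝ) ∩ u ⁻¹' (interior C)ᶜ) →
        u s ∈ interior C := fun s hs hs' => by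
      by_contra h
      exact absurd (csInf_le hbdd ⟨hs, h⟩) (not_le.2 hs')
    generalize sInf (Set.Ici (0 : ℝ) ∩ u ⁻¹' (interior C)ᶜ) = t₁ at h0 hout hlt
    have h0' : 0 < t₁ := lt_of_le_of_ne h0 (by rintro rfl; exact hout hu0)
    have hev : ∀ᶠ s in 𝓝[<] t₁, u s ∈ interior C := by
      filter_upwards [Ioo_mem_nhdsLT h0'] with s hs using hlt s hs.1.le hs.2
    have hmem : u t₁ ∈ C := (isClosed_of_selfDual hC).mem_of_tendsto
      ((hcont.tendsto t₁).mono_left nhdsWithin_le_nhds)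
      (hev.mono fun s hs => interior_subset hs)
    obtain ⟨y, hy, hy0, hyu⟩ := exists_dotProduct_eq_zero_of_notMem_interior hC hmem hout
    have hd := hasDerivAt_dotProduct_left y (hderiv t₁)
    have hle := nonpos_of_hasDerivAt_of_eventually_le_nhdsLT hd (hev.mono fun s hs => by
      rw [hyu]; exact dotProduct_nonneg_of_selfDual hC hy (interior_subset hs))
    rw [dotProduct_add, dotProduct_smul, smul_eq_mul] at hle
    have h1 := hA _ hmem y hy hyu
    have h2 := (mem_interior_iff_of_selfDual hC).1 hM y hy hy0
    have h3 : 0 < δ * Real.exp (M * t₁) := by positivity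
    have := mul_pos h3 h2
    linarith
  have hlim : Tendsto (fun δ : ℝ => exp (t • A) *ᵥ x + (δ * Real.exp (M * t)) • e) (𝓝[>] 0)
      (𝓝 (exp (t • A) *ᵥ x)) := by
    have : Continuous fun δ : ℝ => exp (t • A) *ᵥ x + (δ * Real.exp (M * t)) • e := by fun_prop
    simpa using (this.tendsto 0).mono_left nhdsWithin_le_nhds
  refine (isClosed_of_selfDual hC).mem_of_tendsto hlim ?_
  filter_upwards [self_mem_nhdsWithin] with δ hδ using interior_subset (key δ hδ t ht)

/-- If no `s ≥ 0` is an eigenvalue of the cross-nonnegative matrix `A`, then `-A⁻¹` maps the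
interior of the cone into itself. -/
lemma IsCrossNonneg.exists_mulVec_eq_neg [DecidableEq ι] (hC : dualCone C = C)
    {A : Matrix ι ι ℝ} (hA : IsCrossNonneg C A)
    (hdet : ∀ s : ℝ, 0 ≤ s → (s • (1 : Matrix ι ι ℝ) - A).det ≠ 0)
    {e : ι → ℝ} (he : e ∈ interior C) : ∃ p ∈ interior C, A *ᵥ p = -e := by
  set x : ℝ → ι → ℝ := fun s => (s • (1 : Matrix ι ι ℝ) - A)⁻¹ *ᵥ e with hx
  have hxs : ∀ s, 0 ≤ s → s • x s - A *ᵥ x s = e := by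
    intro s hs
    have h1 : (s • (1 : Matrix ι ι ℝ) - A) *ᵥ x s = e := by
      rw [hx, Matrix.mulVec_mulVec, Matrix.mul_nonsing_inv _ (hdet s hs).isUnit,
        Matrix.one_mulVec]
    rwa [Matrix.sub_mulVec, Matrix.smul_mulVec, Matrix.one_mulVec] at h1
  have hcont : ContinuousOn x (Set.Ici 0) := by
    have h1 : ContinuousOn (fun s : ℝ => (s • (1 : Matrix ι ι ℝ) - A)⁻¹) (Set.Ici 0) := by
      have : ∀ s : ℝ, (s • (1 : Matrix ι ι ℝ) - A)⁻¹ =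
        (s • (1 : Matrix ι ι ℝ) - A).det⁻¹ • (s • (1 : Matrix ι ι ℝ) - A).adjugate := by
        intro s; rw [Matrix.inv_def, Ring.inverse_eq_inv']
      simp_rw [this]
      refine ContinuousOn.smul (ContinuousOn.inv₀ ?_ fun s hs => hdet s hs) ?_
      · exact (Continuous.matrix_det (by fun_prop)).continuousOn
      · exact (Continuous.matrix_adjugate (by fun_prop)).continuousOn
    exact fun s hs => Filter.Tendsto.comp
      ((Continuous.matrix_mulVec continuous_id continuous_const).tendsto _) (h1 s hs)
  -- With `r = 1/s`, the rescaled vector `s • x s = (1 - rA)⁻¹e` tends to `e`.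
  have hlarge : ∃ s, 0 ≤ s ∧ x s ∈ interior C := by
    have h1 : Tendsto (fun r : ℝ => ((1 : Matrix ι ι ℝ) - r • A)⁻¹ *ᵥ e) (𝓝[>] 0) (𝓝 e) := by
      have : ContinuousAt (fun r : ℝ => ((1 : Matrix ι ι ℝ) - r • A)⁻¹ *ᵥ e) 0 := by
        have h2 : ContinuousAt (fun r : ℝ => ((1 : Matrix ι ι ℝ) - r • A)⁻¹) 0 := by
          simp_rw [Matrix.inv_def, Ring.inverse_eq_inv']
          have h3 : ((1 : Matrix ι ι ℝ) - (0 : ℝ) • A).det ≠ 0 := by simp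
          have h4 : Continuous fun r : ℝ => (1 : Matrix ι ι ℝ) - r • A := by fun_prop
          exact (h4.matrix_det.continuousAt.inv₀ h3).smul h4.matrix_adjugate.continuousAt
        exact Filter.Tendsto.comp
          ((Continuous.matrix_mulVec continuous_id continuous_const).tendsto _) h2
      have h2 := this.tendsto.mono_left (nhdsWithin_le_nhds (s := Set.Ioi 0))
      simpa using h2
    obtain ⟨r, hr, hr0⟩ := ((h1.eventually (isOpen_interior.mem_nhds he)).and
      self_mem_nhdsWithin).exists
    replace hr0 : 0 < r := hr0
    refine ⟨r⁻¹, by positivity, ?_⟩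
    have h3 : r⁻¹ • (1 : Matrix ι ι ℝ) - A = r⁻¹ • (1 - r • A) := by
      rw [smul_sub, smul_smul, inv_mul_cancel₀ hr0.ne', one_smul]
    have h4 : ((1 : Matrix ι ι ℝ) - r • A).det ≠ 0 := by
      have := hdet r⁻¹ (by positivity)
      rw [h3, Matrix.det_smul] at this
      exact right_ne_zero_of_mul this
    have h5 : x r⁻¹ = r • (((1 : Matrix ι ι ℝ) - r • A)⁻¹ *ᵥ e) := by
      rw [hx, ← Matrix.smul_mulVec]
      simp only
      congr 1
      rw [h3]
      refine Matrix.inv_eq_right_inv ?_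
      rw [Matrix.smul_mul, Matrix.mul_smul, smul_smul, inv_mul_cancel₀ hr0.ne', one_smul,
        Matrix.mul_nonsing_inv _ h4.isUnit]
    rw [h5]
    exact smul_mem_interior_of_selfDual hC hr hr0
  -- At a boundary point, some nonzero `y ∈ C` orthogonal to `x s` would give `y · e = -y · A(x s) ≤
  -- 0`.
  have hint : ∀ s, 0 ≤ s → x s ∈ C → x s ∈ interior C := by
    intro s hs hsC
    by_contra hns
    obtain ⟨y, hy, hy0, hyx⟩ := exists_dotProduct_eq_zero_of_notMem_interior hC hsC hns
    have h1 := hA _ hsC y hy hyx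
    have h2 := (mem_interior_iff_of_selfDual hC).1 he y hy hy0
    rw [← hxs s hs, dotProduct_sub, dotProduct_smul, hyx, smul_zero] at h2
    linarith
  -- By `hint`, the half-line is the disjoint union of the relatively open sets where `x s` is
  -- interior and where `x s ∉ C`; it is connected.
  have hall : Set.Ici (0 : ℝ) ⊆ x ⁻¹' interior C := by
    obtain ⟨s, hs, hsC⟩ := hlarge
    obtain ⟨U, hU, hU'⟩ := (continuousOn_iff'.1 hcont) _ (isOpen_interior (s := C))
    obtain ⟨V, hV, hV'⟩ := (continuousOn_iff'.1 hcont) _ (isClosed_of_selfDual hC).isOpen_compl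
    have hcov : Set.Ici (0 : ℝ) ⊆ U ∪ V := by
      intro r hr
      by_cases h : x r ∈ C
      · left
        have : r ∈ x ⁻¹' interior C ∩ Set.Ici 0 := ⟨hint r hr h, hr⟩
        rw [hU'] at this
        exact this.1
      · right
        have : r ∈ x ⁻¹' Cᶜ ∩ Set.Ici 0 := ⟨h, hr⟩
        rw [hV'] at this
        exact this.1
    intro r hr
    by_contra hrn
    have hrV : r ∈ V := by
      have : r ∈ x ⁻¹' Cᶜ ∩ Set.Ici 0 := ⟨fun h => hrn (hint r hr h), hr⟩
      rw [hV'] at this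
      exact this.1
    have hsU : s ∈ U := by
      have : s ∈ x ⁻¹' interior C ∩ Set.Ici 0 := ⟨hsC, hs⟩
      rw [hU'] at this
      exact this.1
    obtain ⟨w, hw0, hwU, hwV⟩ := isPreconnected_Ici U V hU hV hcov ⟨s, hs, hsU⟩ ⟨r, hr, hrV⟩
    have h1 : w ∈ x ⁻¹' interior C ∩ Set.Ici 0 := hU' ▸ ⟨hwU, hw0⟩
    have h2 : w ∈ x ⁻¹' Cᶜ ∩ Set.Ici 0 := hV' ▸ ⟨hwV, hw0⟩
    exact h2.1 (interior_subset h1.1)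
  refine ⟨x 0, hall Set.self_mem_Ici, ?_⟩
  have := hxs 0 le_rfl
  rw [zero_smul, zero_sub] at this
  rw [← this, neg_neg]

/-- A real eigenvalue of a cross-nonnegative matrix that maps some interior point `p` of the cone
to the negative of an interior point is negative. -/
lemma IsCrossNonneg.eigenvalue_neg (hC : dualCone C = C) {B : Matrix ι ι ℝ}
    (hB : IsCrossNonneg C B) {p : ι → ℝ} (hp : p ∈ interior C)
    (hBp : -(B *ᵥ p) ∈ interior C) {x : ι → ℝ} (hx : x ≠ 0) {l : ℝ} (hl : B *ᵥ x = l • x) :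
    l < 0 := by
  -- The cone is pointed, so `x` or `-x` may be taken outside it.
  wlog hxC : -x ∉ C generalizing x
  · refine this (x := -x) (neg_ne_zero.2 hx) (by rw [Matrix.mulVec_neg, hl, smul_neg]) ?_
    rw [neg_neg]
    exact fun h => hx (eq_zero_of_neg_mem hC h (not_not.1 hxC))
  by_contra! hl0
  -- At the least `r` in `S`, the point `r • p - x` lies on the boundary, orthogonal to some nonzero
  -- `y ∈ C`. If `l ≥ 0`, then `y · B(rp - x) = r (y · Bp) - l r (y · p) < 0`, against
  -- cross-nonnegativity.
  set S : Set ℝ := {r | 0 ≤ r ∧ r • p - x ∈ C}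
  have hSc : IsClosed S := by
    refine isClosed_Ici.inter ((isClosed_of_selfDual hC).preimage ?_)
    fun_prop
  have hSb : BddBelow S := ⟨0, fun r hr => hr.1⟩
  have hSne : S.Nonempty := by
    have hcont : Tendsto (fun r : ℝ => p - r • x) (𝓝[>] 0) (𝓝 p) := by
      have : Continuous fun r : ℝ => p - r • x := by fun_prop
      simpa using (this.tendsto 0).mono_left nhdsWithin_le_nhds
    obtain ⟨r, hr, hr0⟩ := ((hcont.eventually (mem_interior_iff_mem_nhds.1 hp)).and
      self_mem_nhdsWithin).exists
    replace hr0 : 0 < r := hr0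
    refine ⟨r⁻¹, by positivity, ?_⟩
    have := smul_mem_of_selfDual hC hr (inv_nonneg.2 hr0.le)
    rwa [smul_sub, smul_smul, inv_mul_cancel₀ hr0.ne', one_smul] at this
  obtain ⟨h0, hmem⟩ := hSc.csInf_mem hSne hSb
  have hmin : ∀ r, 0 ≤ r → r • p - x ∈ C → sInf S ≤ r := fun r hr hr' => csInf_le hSb ⟨hr, hr'⟩
  generalize sInf S = r at h0 hmem hmin
  have hr : 0 < r := lt_of_le_of_ne h0 (by rintro rfl; simp at hmem; exact hxC hmem)
  have hbd : r • p - x ∉ interior C := by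
    intro h
    have hcont : Tendsto (fun s : ℝ => s • p - x) (𝓝[<] r) (𝓝 (r • p - x)) := by
      have : Continuous fun s : ℝ => s • p - x := by fun_prop
      exact (this.tendsto r).mono_left nhdsWithin_le_nhds
    obtain ⟨s, hs, hs0⟩ := ((hcont.eventually (mem_interior_iff_mem_nhds.1 h)).and
      (Ioo_mem_nhdsLT hr)).exists
    exact absurd (hmin s hs0.1.le hs) (not_le.2 hs0.2)
  obtain ⟨y, hy, hy0, hyx⟩ := exists_dotProduct_eq_zero_of_notMem_interior hC hmem hbd
  have h1 := hB _ hmem y hy hyx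
  have h2 := (mem_interior_iff_of_selfDual hC).1 hp y hy hy0
  have h3 := (mem_interior_iff_of_selfDual hC).1 hBp y hy hy0
  rw [Matrix.mulVec_sub, Matrix.mulVec_smul, hl, dotProduct_sub, dotProduct_smul,
    dotProduct_smul, smul_eq_mul, smul_eq_mul] at h1
  rw [dotProduct_neg] at h3
  rw [dotProduct_sub, dotProduct_smul, smul_eq_mul] at hyx
  have h4 := mul_pos hr h3
  have h5 := mul_nonneg hl0 (mul_pos hr h2).le
  have h6 : y ⬝ᵥ x = r * (y ⬝ᵥ p) := by linarith
  rw [h6] at h1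
  linarith

/-- Through this, self-duality makes the automorphism group stable under transposition, so that it
contains the products `gᵀg`. -/
lemma transpose_mulVec_mem (hC : dualCone C = C) {L : Matrix ι ι ℝ}
    (hL : ∀ x ∈ C, L *ᵥ x ∈ C) {x : ι → ℝ} (hx : x ∈ C) : Lᵀ *ᵥ x ∈ C := by
  rw [mem_iff_of_selfDual hC]
  intro y hy
  rw [Matrix.mulVec_transpose, ← Matrix.dotProduct_mulVec]
  exact dotProduct_nonneg_of_selfDual hC hx (hL y hy)

/-- `X` lies in the Lie algebra of the automorphism group of the self-dual cone `C`. -/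
def IsConeDerivation (C : Set (ι → ℝ)) (X : Matrix ι ι ℝ) : Prop :=
  ∀ x ∈ C, ∀ y ∈ C, y ⬝ᵥ x = 0 → y ⬝ᵥ (X *ᵥ x) = 0

lemma IsConeDerivation.transpose {X : Matrix ι ι ℝ} (hX : IsConeDerivation C X) :
    IsConeDerivation C Xᵀ := by
  intro x hx y hy h
  rw [Matrix.mulVec_transpose, dotProduct_comm, ← Matrix.dotProduct_mulVec]
  exact hX y hy x hx (by rwa [dotProduct_comm])

lemma IsConeDerivation.add {X Y : Matrix ι ι ℝ} (hX : IsConeDerivation C X)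
    (hY : IsConeDerivation C Y) : IsConeDerivation C (X + Y) := by
  intro x hx y hy h
  rw [Matrix.add_mulVec, dotProduct_add, hX x hx y hy h, hY x hx y hy h, add_zero]

lemma IsConeDerivation.smul {X : Matrix ι ι ℝ} (hX : IsConeDerivation C X) (a : ℝ) :
    IsConeDerivation C (a • X) := by
  intro x hx y hy h
  rw [Matrix.smul_mulVec, dotProduct_smul, hX x hx y hy h, smul_zero]

end CrossNonneg

/-! ### The automorphism group: compactness and a fixed point. -/

section Automorphisms

open NormedSpace
open scoped Matrix.Norms.Operator

variable {ι : Type*} [Fintype ι] [DecidableEq ι] {C : Set (ι → ℝ)}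

/-- The automorphism group of `C`, as the set of pairs of an automorphism and its inverse. -/
def conePairs (C : Set (ι → ℝ)) : Set (Matrix ι ι ℝ × Matrix ι ι ℝ) :=
  {g | g.1 * g.2 = 1 ∧ (∀ x ∈ C, g.1 *ᵥ x ∈ C) ∧ ∀ x ∈ C, g.2 *ᵥ x ∈ C}

lemma isClosed_conePairs (hC : IsClosed C) : IsClosed (conePairs C) := by
  have h1 : IsClosed {g : Matrix ι ι ℝ × Matrix ι ι ℝ | g.1 * g.2 = 1} :=
    isClosed_eq (by fun_prop) continuous_const
  have h2 : IsClosed (⋂ x ∈ C, {g : Matrix ι ι ℝ × Matrix ι ι ℝ | g.1 *ᵥ x ∈ C}) :=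
    isClosed_biInter fun x _ => hC.preimage (continuous_fst.matrix_mulVec continuous_const)
  have h3 : IsClosed (⋂ x ∈ C, {g : Matrix ι ι ℝ × Matrix ι ι ℝ | g.2 *ᵥ x ∈ C}) :=
    isClosed_biInter fun x _ => hC.preimage (continuous_snd.matrix_mulVec continuous_const)
  convert h1.inter (h2.inter h3) using 1
  ext g
  simp [conePairs]

lemma one_mem_conePairs : ((1, 1) : Matrix ι ι ℝ × Matrix ι ι ℝ) ∈ conePairs C := by
  simp [conePairs]

lemma mul_mem_conePairs {g h : Matrix ι ι ℝ × Matrix ι ι ℝ} (hg : g ∈ conePairs C)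
    (hh : h ∈ conePairs C) : (g.1 * h.1, h.2 * g.2) ∈ conePairs C := by
  refine ⟨?_, fun x hx => ?_, fun x hx => ?_⟩
  · calc g.1 * h.1 * (h.2 * g.2) = g.1 * (h.1 * h.2) * g.2 := by simp only [Matrix.mul_assoc]
      _ = 1 := by rw [hh.1, Matrix.mul_one, hg.1]
  · simp only
    rw [← Matrix.mulVec_mulVec]
    exact hg.2.1 _ (hh.2.1 x hx)
  · simp only
    rw [← Matrix.mulVec_mulVec]
    exact hh.2.2 _ (hg.2.2 x hx)

lemma swap_mem_conePairs {g : Matrix ι ι ℝ × Matrix ι ι ℝ} (hg : g ∈ conePairs C) :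
    (g.2, g.1) ∈ conePairs C :=
  ⟨mul_eq_one_comm.1 hg.1, hg.2.2, hg.2.1⟩

lemma transpose_mem_conePairs (hC : dualCone C = C) {g : Matrix ι ι ℝ × Matrix ι ι ℝ}
    (hg : g ∈ conePairs C) : (g.1ᵀ, g.2ᵀ) ∈ conePairs C := by
  refine ⟨?_, fun x hx => transpose_mulVec_mem hC hg.2.1 hx,
    fun x hx => transpose_mulVec_mem hC hg.2.2 hx⟩
  simp only
  rw [← Matrix.transpose_mul, mul_eq_one_comm.1 hg.1, Matrix.transpose_one]

lemma mem_coneAut_of_mem_conePairs {g : Matrix ι ι ℝ × Matrix ι ι ℝ}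
    (hg : g ∈ conePairs C) : g.1 ∈ coneAut C := by
  refine Set.Subset.antisymm ?_ fun x hx => ⟨g.2 *ᵥ x, hg.2.2 x hx, ?_⟩
  · rintro _ ⟨x, hx, rfl⟩
    exact hg.2.1 x hx
  · simp only
    rw [Matrix.mulVec_mulVec, hg.1, Matrix.one_mulVec]

/-- A vector in the left kernel of `L` is orthogonal to `L(C) = C`, hence zero. -/
lemma exists_mem_conePairs_of_mem_coneAut (hC : dualCone C = C) {L : Matrix ι ι ℝ}
    (hL : L ∈ coneAut C) : ∃ g ∈ conePairs C, g.1 = L := by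
  have hL' : (fun x => L *ᵥ x) '' C = C := hL
  have hdet : IsUnit L := by
    rw [← Matrix.vecMul_injective_iff_isUnit, ← Matrix.coe_vecMulLinear,
      injective_iff_map_eq_zero]
    intro v hv
    refine eq_zero_of_forall_dotProduct_eq_zero hC fun x hx => ?_
    rw [← hL'] at hx
    obtain ⟨y, hy, rfl⟩ := hx
    simp only [Matrix.coe_vecMulLinear] at hv
    rw [Matrix.dotProduct_mulVec, hv, zero_dotProduct]
  rw [Matrix.isUnit_iff_isUnit_det] at hdet
  refine ⟨(L, L⁻¹), ⟨Matrix.mul_nonsing_inv _ hdet, fun x hx => ?_, fun x hx => ?_⟩, rfl⟩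
  · rw [← hL']
    exact ⟨x, hx, rfl⟩
  · rw [← hL'] at hx
    obtain ⟨y, hy, rfl⟩ := hx
    simpa [Matrix.mulVec_mulVec, Matrix.nonsing_inv_mul _ hdet] using hy

/-- For small `u`, both `p ± u` lie in `C`, hence so do `L(p ± u)`. There `q` dominates the norm,
and adding the two bounds controls `Lu` by `q · Lp`. -/
lemma exists_norm_le_mul_dotProduct (hC : dualCone C = C) {p q : ι → ℝ} (hp : p ∈ interior C)
    (hq : q ∈ interior C) : ∃ K : ℝ, 0 ≤ K ∧ ∀ L : Matrix ι ι ℝ, (∀ x ∈ C, L *ᵥ x ∈ C) →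
      ‖L‖ ≤ K * (q ⬝ᵥ (L *ᵥ p)) := by
  obtain ⟨m, hm, hmq⟩ := exists_mul_norm_le hC ((mem_interior_iff_of_selfDual hC).1 hq)
  obtain ⟨δ, hδ, hball⟩ := Metric.nhds_basis_closedBall.mem_iff.1
    (mem_interior_iff_mem_nhds.1 hp)
  refine ⟨δ⁻¹ * m⁻¹, by positivity, fun L hL => ?_⟩
  have h0 : 0 ≤ q ⬝ᵥ (L *ᵥ p) :=
    dotProduct_nonneg_of_selfDual hC (interior_subset hq) (hL p (interior_subset hp))
  have hle : ∀ u : ι → ℝ, ‖u‖ ≤ δ → m * ‖L *ᵥ u‖ ≤ q ⬝ᵥ (L *ᵥ p) := by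
    intro u hu
    have h1 := hmq _ (hL (p + u) (hball (by simpa [mem_closedBall_iff_norm] using hu)))
    have h2 := hmq _ (hL (p - u) (hball (by simpa [mem_closedBall_iff_norm] using hu)))
    have h3 : ‖(2 : ℝ) • (L *ᵥ u)‖ ≤ ‖L *ᵥ (p + u)‖ + ‖L *ᵥ (p - u)‖ := by
      refine le_trans (le_of_eq ?_) (norm_sub_le _ _)
      rw [Matrix.mulVec_add, Matrix.mulVec_sub]
      congr 1
      module
    rw [norm_smul, Real.norm_ofNat] at h3
    rw [dotProduct_comm, Matrix.mulVec_add, dotProduct_add] at h1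
    rw [dotProduct_comm, Matrix.mulVec_sub, dotProduct_sub] at h2
    rw [← Matrix.mulVec_add] at h1
    rw [← Matrix.mulVec_sub] at h2
    nlinarith
  rw [Matrix.linfty_opNorm_eq_opNorm]
  refine ContinuousLinearMap.opNorm_le_bound _ (by positivity) fun x => ?_
  change ‖L *ᵥ x‖ ≤ _
  by_cases hx : x = 0
  · simp [hx]
  have hn : 0 < ‖x‖ := norm_pos_iff.2 hx
  have h1 := hle ((δ * ‖x‖⁻¹) • x) (by
    rw [norm_smul, Real.norm_of_nonneg (by positivity), mul_assoc, inv_mul_cancel₀ hn.ne',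
      mul_one])
  rw [Matrix.mulVec_smul, norm_smul, Real.norm_of_nonneg (by positivity)] at h1
  calc ‖L *ᵥ x‖ = δ⁻¹ * m⁻¹ * (m * (δ * ‖x‖⁻¹ * ‖L *ᵥ x‖)) * ‖x‖ := by
        field_simp
    _ ≤ δ⁻¹ * m⁻¹ * (q ⬝ᵥ (L *ᵥ p)) * ‖x‖ := by gcongr

lemma isCompact_conePairs_inter (hC : dualCone C = C) {p q p' q' : ι → ℝ}
    (hp : p ∈ interior C) (hq : q ∈ interior C) (hp' : p' ∈ interior C) (hq' : q' ∈ interior C)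
    (M M' : ℝ) : IsCompact
      (conePairs C ∩ {g | q ⬝ᵥ (g.1 *ᵥ p) ≤ M ∧ q' ⬝ᵥ (g.2 *ᵥ p') ≤ M'}) := by
  obtain ⟨K, hK, hbd⟩ := exists_norm_le_mul_dotProduct hC hp hq
  obtain ⟨K', hK', hbd'⟩ := exists_norm_le_mul_dotProduct hC hp' hq'
  refine Metric.isCompact_of_isClosed_isBounded ?_ ?_
  · refine (isClosed_conePairs (isClosed_of_selfDual hC)).inter (IsClosed.inter ?_ ?_)
    · exact isClosed_le (continuous_const.dotProduct
        (continuous_fst.matrix_mulVec continuous_const)) continuous_const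
    · exact isClosed_le (continuous_const.dotProduct
        (continuous_snd.matrix_mulVec continuous_const)) continuous_const
  · refine ((Metric.isBounded_closedBall (x := (0 : Matrix ι ι ℝ)) (r := K * M)).prod
      (Metric.isBounded_closedBall (x := (0 : Matrix ι ι ℝ)) (r := K' * M'))).subset ?_
    rintro g ⟨hg, h1, h2⟩
    refine ⟨?_, ?_⟩ <;> rw [mem_closedBall_zero_iff]
    · exact (hbd _ hg.2.1).trans (mul_le_mul_of_nonneg_left h1 hK)
    · exact (hbd' _ hg.2.2).trans (mul_le_mul_of_nonneg_left h2 hK')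

/-- Both `X` and `-X` are cross-nonnegative, so both exponentials preserve `C`. -/
lemma IsConeDerivation.exp_mem_conePairs (hC : dualCone C = C) {X : Matrix ι ι ℝ}
    (hX : IsConeDerivation C X) : (exp X, exp (-X)) ∈ conePairs C := by
  have hmem : ∀ Y : Matrix ι ι ℝ, IsConeDerivation C Y → ∀ x ∈ C, exp Y *ᵥ x ∈ C := by
    intro Y hY x hx
    have hY' : IsCrossNonneg C Y := fun x hx y hy h => (hY x hx y hy h).ge
    simpa using hY'.exp_mulVec_mem hC hx zero_le_one
  refine ⟨?_, hmem X hX, hmem _ (by simpa using hX.smul (-1))⟩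
  simp only
  rw [← Matrix.exp_add_of_commute _ _ (Commute.neg_right (Commute.refl X)), add_neg_cancel,
    exp_zero]

lemma exp_mulVec_eq_self {X : Matrix ι ι ℝ} {x : ι → ℝ} (h : X *ᵥ x = 0) :
    exp X *ᵥ x = x := by
  have hd : ∀ t : ℝ, HasDerivAt (fun s : ℝ => exp (s • X) *ᵥ x) 0 t := by
    intro t
    have h1 := hasDerivAt_exp_smul_mulVec X x t
    have hcomm : X * exp (t • X) = exp (t • X) * X :=
      ((Commute.refl X).smul_right t).exp_right
    rwa [Matrix.mulVec_mulVec, hcomm, ← Matrix.mulVec_mulVec, h, Matrix.mulVec_zero] at h1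
  have := is_const_of_deriv_eq_zero (fun t => (hd t).differentiableAt)
    (fun t => (hd t).deriv) 1 0
  simpa using this

/-- There is an interior point of `C` that is fixed by all orthogonal automorphisms. -/
lemma exists_mem_interior_fixed (hC : dualCone C = C) : ∃ e ∈ interior C,
    ∀ g : Matrix ι ι ℝ, (g, gᵀ) ∈ conePairs C → g *ᵥ e = e := by
  -- Euclidean lengths and `C` are preserved by orthogonal automorphisms, hence so is the convex set
  -- `D`. Its point of least Euclidean norm is unique, and therefore fixed.
  set D : Set (ι → ℝ) := {x | ∀ u ∈ C, Real.sqrt (u ⬝ᵥ u) ≤ u ⬝ᵥ x} with hD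
  have hDint : D ⊆ interior C := fun x hx => (mem_interior_iff_of_selfDual hC).2
    fun y hy hy0 => (Real.sqrt_pos.2 (dotProduct_self_pos hy0)).trans_le (hx y hy)
  have hDc : IsClosed D := by
    have : D = ⋂ u ∈ C, {x | Real.sqrt (u ⬝ᵥ u) ≤ u ⬝ᵥ x} := by ext x; simp [hD]
    rw [this]
    exact isClosed_biInter fun u _ =>
      isClosed_le continuous_const (continuous_const.dotProduct continuous_id)
  obtain ⟨x₀, hx₀⟩ : D.Nonempty := by
    obtain ⟨x, hx⟩ := interior_nonempty_of_selfDual hC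
    obtain ⟨m, hm, h⟩ := exists_mul_norm_le hC ((mem_interior_iff_of_selfDual hC).1 hx)
    refine ⟨((Fintype.card ι + 1) * m⁻¹) • x, fun u hu => ?_⟩
    rw [dotProduct_smul, smul_eq_mul]
    have h1 : Real.sqrt (u ⬝ᵥ u) ≤ (Fintype.card ι + 1) * ‖u‖ := by
      refine Real.sqrt_le_iff.2 ⟨by positivity, ?_⟩
      have := (le_abs_self _).trans (abs_dotProduct_le u u)
      nlinarith [norm_nonneg u, mul_nonneg (Nat.cast_nonneg (α := ℝ) (Fintype.card ι))
        (sq_nonneg ‖u‖), sq_nonneg ‖u‖, sq_nonneg ((Fintype.card ι : ℝ) * ‖u‖)]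
    calc Real.sqrt (u ⬝ᵥ u) ≤ (Fintype.card ι + 1) * ‖u‖ := h1
      _ = (Fintype.card ι + 1) * m⁻¹ * (m * ‖u‖) := by field_simp
      _ ≤ _ := by gcongr; exact h u hu
  have hcont : Continuous fun x : ι → ℝ => x ⬝ᵥ x := continuous_id.dotProduct continuous_id
  have hcpt : IsCompact (D ∩ {x | x ⬝ᵥ x ≤ x₀ ⬝ᵥ x₀}) := by
    refine Metric.isCompact_of_isClosed_isBounded
      (hDc.inter (isClosed_le hcont continuous_const)) ?_
    refine (Metric.isBounded_closedBall (x := (0 : ι → ℝ))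
      (r := Real.sqrt (x₀ ⬝ᵥ x₀))).subset ?_
    rintro x ⟨-, hx⟩
    rw [mem_closedBall_zero_iff]
    exact Real.le_sqrt_of_sq_le ((norm_sq_le_dotProduct_self x).trans hx)
  obtain ⟨e, ⟨heD, hex⟩, hmin⟩ := hcpt.exists_isMinOn ⟨x₀, hx₀, le_refl (x₀ ⬝ᵥ x₀)⟩
    hcont.continuousOn
  have hmin' : ∀ x ∈ D, e ⬝ᵥ e ≤ x ⬝ᵥ x := by
    intro x hx
    by_cases h : x ⬝ᵥ x ≤ x₀ ⬝ᵥ x₀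
    · exact hmin ⟨hx, h⟩
    · exact le_trans hex (not_le.1 h).le
  refine ⟨e, hDint heD, fun g hg => ?_⟩
  have hgg : ∀ x : ι → ℝ, (gᵀ *ᵥ x) ⬝ᵥ (gᵀ *ᵥ x) = x ⬝ᵥ x := by
    intro x
    conv_lhs => rw [Matrix.dotProduct_mulVec, Matrix.vecMul_transpose, Matrix.mulVec_mulVec]
    rw [show g * gᵀ = 1 from hg.1, Matrix.one_mulVec]
  have hgg' : (g *ᵥ e) ⬝ᵥ (g *ᵥ e) = e ⬝ᵥ e := by
    rw [← hgg (g *ᵥ e), Matrix.mulVec_mulVec, mul_eq_one_comm.1 hg.1, Matrix.one_mulVec]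
  -- If `g e ≠ e`, this midpoint of two vectors of equal length would be shorter than `e`.
  have hmid : (1 / 2 : ℝ) • (e + g *ᵥ e) ∈ D := by
    intro u hu
    have h1 := heD u hu
    have h2 := heD _ (hg.2.2 u hu)
    simp only at h2
    rw [hgg, Matrix.mulVec_transpose, ← Matrix.dotProduct_mulVec] at h2
    rw [dotProduct_smul, dotProduct_add, smul_eq_mul]
    linarith
  have h1 := hmin' _ hmid
  rw [smul_dotProduct, dotProduct_smul, add_dotProduct, dotProduct_add, dotProduct_add,
    hgg', dotProduct_comm (g *ᵥ e) e, smul_eq_mul, smul_eq_mul] at h1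
  have h2 : (g *ᵥ e - e) ⬝ᵥ (g *ᵥ e - e) ≤ 0 := by
    rw [sub_dotProduct, dotProduct_sub, dotProduct_sub, hgg', dotProduct_comm (g *ᵥ e) e]
    linarith
  by_contra hne
  exact absurd (dotProduct_self_pos (sub_ne_zero.2 hne)) (not_lt.2 h2)

end Automorphisms

/-! ### The Lie algebra at an interior point, and positive definite automorphisms. -/

section Tangent

open NormedSpace
open scoped Matrix.Norms.Operator

variable {ι : Type*} [Fintype ι] [DecidableEq ι] {C : Set (ι → ℝ)}

/-- Among the automorphisms that map `e` to `x`, one is nearest to the identity. -/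
lemma exists_nearest_automorphism (hC : IsSymmetricCone C) {e x : ι → ℝ} (he : e ∈ interior C)
    (hx : x ∈ interior C) : ∃ g ∈ conePairs C, g.1 *ᵥ e = x ∧
      ∀ h ∈ conePairs C, h.1 *ᵥ e = x → ‖g.1 - 1‖ ≤ ‖h.1 - 1‖ := by
  have hcpt : IsCompact (conePairs C ∩ {g | g.1 *ᵥ e = x}) := by
    refine (isCompact_conePairs_inter hC.selfDual he he hx he (e ⬝ᵥ x) (e ⬝ᵥ e)).of_isClosed_subset
      ((isClosed_conePairs (isClosed_of_selfDual hC.selfDual)).inter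
        (isClosed_eq (continuous_fst.matrix_mulVec continuous_const) continuous_const)) ?_
    rintro g ⟨hg, hgx⟩
    replace hgx : g.1 *ᵥ e = x := hgx
    refine ⟨hg, by rw [hgx], ?_⟩
    rw [← hgx, Matrix.mulVec_mulVec, mul_eq_one_comm.1 hg.1, Matrix.one_mulVec]
  obtain ⟨L, hL, hLx⟩ := hC.homogeneous e he x hx
  obtain ⟨g₀, hg₀, rfl⟩ := exists_mem_conePairs_of_mem_coneAut hC.selfDual hL
  obtain ⟨g, hg, hmin⟩ := hcpt.exists_isMinOn (f := fun g => ‖g.1 - 1‖) ⟨g₀, hg₀, hLx⟩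
    (by fun_prop)
  exact ⟨g, hg.1, hg.2, fun h hh hhx => hmin ⟨hh, hhx⟩⟩

/-- Nearest automorphisms that map `e` to points tending to `e` tend to the identity, along a
subsequence. -/
lemma exists_subseq_nearest_tendsto_one (hC : dualCone C = C) {e : ι → ℝ}
    (he : e ∈ interior C) {x : ℕ → ι → ℝ} (hx : ∀ n, x n - (1 / 2 : ℝ) • e ∈ C)
    (hxe : Tendsto x atTop (𝓝 e)) {G : ℕ → Matrix ι ι ℝ × Matrix ι ι ℝ}
    (hG : ∀ n, G n ∈ conePairs C) (hGx : ∀ n, (G n).1 *ᵥ e = x n)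
    (hmin : ∀ n, ∀ h ∈ conePairs C, h.1 *ᵥ e = x n → ‖(G n).1 - 1‖ ≤ ‖h.1 - 1‖) :
    ∃ φ : ℕ → ℕ, StrictMono φ ∧ Tendsto (fun n => G (φ n)) atTop (𝓝 (1, 1)) := by
  obtain ⟨M, hM⟩ : ∃ M, ∀ n, e ⬝ᵥ x n ≤ M := by
    have h1 : Tendsto (fun n => e ⬝ᵥ x n) atTop (𝓝 (e ⬝ᵥ e)) :=
      ((continuous_const.dotProduct continuous_id).tendsto e).comp hxe
    obtain ⟨M, hM⟩ := h1.bddAbove_range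
    exact ⟨M, fun n => hM ⟨n, rfl⟩⟩
  have hcpt := isCompact_conePairs_inter hC he he he he M (2 * (e ⬝ᵥ e))
  have : FirstCountableTopology (Matrix ι ι ℝ) :=
    inferInstanceAs (FirstCountableTopology (ι → ι → ℝ))
  obtain ⟨k, ⟨hk, -⟩, φ, hφ, hlim⟩ := hcpt.tendsto_subseq (x := G) fun n => by
    refine ⟨hG n, by rw [hGx]; exact hM n, ?_⟩
    -- The inverse sends `x n` to `e`, so applying it to `x n - e/2 ∈ C` bounds its value at `e`.
    have h1 := dotProduct_nonneg_of_selfDual hC (interior_subset he) ((hG n).2.2 _ (hx n))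
    rw [Matrix.mulVec_sub, Matrix.mulVec_smul, dotProduct_sub, dotProduct_smul, smul_eq_mul,
      ← hGx, Matrix.mulVec_mulVec, mul_eq_one_comm.1 (hG n).1, Matrix.one_mulVec] at h1
    linarith
  have h1 : Tendsto (fun n => (G (φ n)).1) atTop (𝓝 k.1) := (continuous_fst.tendsto k).comp hlim
  have hke : k.1 *ᵥ e = e := by
    refine tendsto_nhds_unique (((continuous_id.matrix_mulVec continuous_const).tendsto k.1).comp
      h1) ?_
    refine (hxe.comp hφ.tendsto_atTop).congr fun n => ?_
    simp [hGx]
  have hke' : k.2 *ᵥ e = e := by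
    conv_lhs => rw [← hke]
    rw [Matrix.mulVec_mulVec, mul_eq_one_comm.1 hk.1, Matrix.one_mulVec]
  -- The limit `k` fixes `e`, so `G k⁻¹` competes with `G`; it tends to `1`, and minimality drags
  -- `G` to `1` as well.
  have hle : ∀ n, ‖(G (φ n)).1 - 1‖ ≤ ‖(G (φ n)).1 * k.2 - 1‖ := fun n => by
    have h2 := hmin (φ n) _ (mul_mem_conePairs (hG (φ n)) (swap_mem_conePairs hk)) (by
      simp only
      rw [← Matrix.mulVec_mulVec, hke', hGx])
    simpa only using h2
  have hzero : Tendsto (fun n => ‖(G (φ n)).1 * k.2 - 1‖) atTop (𝓝 0) := by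
    have := ((h1.mul_const k.2).sub_const 1).norm
    simpa [hk.1] using this
  have hone : k.1 = 1 := by
    refine tendsto_nhds_unique h1 ?_
    exact tendsto_iff_norm_sub_tendsto_zero.2
      (squeeze_zero (fun _ => norm_nonneg _) hle hzero)
  have hone' : k.2 = 1 := by simpa [hone] using hk.1
  have hk1 : k = (1, 1) := Prod.ext hone hone'
  rw [hk1] at hlim
  exact ⟨φ, hφ, hlim⟩

/-- Rescaled limits of automorphisms tending to the identity lie in the Lie algebra. -/
lemma isConeDerivation_of_tendsto (hC : dualCone C = C) {X : Matrix ι ι ℝ} {m : ℕ → ℝ}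
    (hm : ∀ n, 0 < m n) {G : ℕ → Matrix ι ι ℝ × Matrix ι ι ℝ} (hG : ∀ n, G n ∈ conePairs C)
    (hG1 : Tendsto G atTop (𝓝 (1, 1)))
    (hX : Tendsto (fun n => (m n)⁻¹ • ((G n).1 - 1)) atTop (𝓝 X)) : IsConeDerivation C X := by
  have key : ∀ (g : ℕ → Matrix ι ι ℝ) (Y : Matrix ι ι ℝ), (∀ n, ∀ x ∈ C, g n *ᵥ x ∈ C) →
      Tendsto (fun n => (m n)⁻¹ • (g n - 1)) atTop (𝓝 Y) → ∀ x ∈ C, ∀ y ∈ C, y ⬝ᵥ x = 0 →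
      0 ≤ y ⬝ᵥ (Y *ᵥ x) := by
    intro g Y hg hY x hx y hy h
    have hcont : Continuous fun Z : Matrix ι ι ℝ => y ⬝ᵥ (Z *ᵥ x) :=
      continuous_const.dotProduct (continuous_id.matrix_mulVec continuous_const)
    refine ge_of_tendsto' ((hcont.tendsto Y).comp hY) fun n => ?_
    simp only [Function.comp_apply]
    rw [Matrix.smul_mulVec, Matrix.sub_mulVec, Matrix.one_mulVec, dotProduct_smul,
      dotProduct_sub, h, sub_zero]
    exact smul_nonneg (inv_nonneg.2 (hm n).le) (dotProduct_nonneg_of_selfDual hC hy (hg n x hx))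
  -- Since `g⁻¹ - 1 = -g⁻¹(g - 1)`, the inverses have rescaled limit `-X`, which gives the opposite
  -- inequality.
  have hX' : Tendsto (fun n => (m n)⁻¹ • ((G n).2 - 1)) atTop (𝓝 (-X)) := by
    have h1 : Tendsto (fun n => (G n).2) atTop (𝓝 1) := (continuous_snd.tendsto _).comp hG1
    have h2 := (h1.mul hX).neg
    rw [one_mul] at h2
    refine h2.congr fun n => ?_
    rw [Matrix.mul_smul, Matrix.mul_sub, mul_eq_one_comm.1 (hG n).1, Matrix.mul_one]
    module
  intro x hx y hy h
  have h1 := key _ X (fun n => (hG n).2.1) hX x hx y hy h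
  have h2 := key _ (-X) (fun n => (hG n).2.2) hX' x hx y hy h
  rw [Matrix.neg_mulVec, dotProduct_neg] at h2
  linarith

/-- A compactness argument replaces the submersion property of the orbit map: automorphisms nearest
to `1` carrying `e` to `e + t v` are rescaled and a limit is taken. -/
lemma exists_isConeDerivation_mulVec_eq_of_segment (hC : IsSymmetricCone C) {e v : ι → ℝ}
    (he : e ∈ interior C) (hv : ∀ t : ℝ, 0 < t → t ≤ 1 → e + t • v - (1 / 2 : ℝ) • e ∈ C) :
    ∃ X, IsConeDerivation C X ∧ X *ᵥ e = v := by
  have hsd := hC.selfDual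
  have hint : ∀ t : ℝ, 0 < t → t ≤ 1 → e + t • v ∈ interior C := fun t h0 h1 => by
    have := add_mem_interior_of_selfDual hsd
      (smul_mem_interior_of_selfDual hsd he (a := 1 / 2) (by norm_num)) (hv t h0 h1)
    rwa [add_sub_cancel] at this
  have hτ0 : ∀ n : ℕ, (0 : ℝ) < 1 / ((n : ℝ) + 1) := fun n => by positivity
  have hτ1 : ∀ n : ℕ, 1 / ((n : ℝ) + 1) ≤ 1 := fun n => by
    rw [div_le_one (by positivity)]; linarith [Nat.cast_nonneg (α := ℝ) n]
  have hτ : Tendsto (fun n : ℕ => 1 / ((n : ℝ) + 1)) atTop (𝓝 0) :=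
    tendsto_one_div_add_atTop_nhds_zero_nat
  choose G₀ hG₀ hG₀x hG₀min using fun n : ℕ =>
    exists_nearest_automorphism hC he (hint _ (hτ0 n) (hτ1 n))
  have hxe : Tendsto (fun n : ℕ => e + (1 / ((n : ℝ) + 1)) • v) atTop (𝓝 e) := by
    simpa using (hτ.smul_const v).const_add e
  obtain ⟨φ, hφ, hlim₀⟩ := exists_subseq_nearest_tendsto_one hsd he
    (fun n => hv _ (hτ0 n) (hτ1 n)) hxe hG₀ hG₀x hG₀min
  obtain ⟨G, t, ht, htlim, hG, hGx, hGmin, hlim⟩ : ∃ (G : ℕ → Matrix ι ι ℝ × Matrix ι ι ℝ)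
      (t : ℕ → ℝ), (∀ n, 0 < t n) ∧ Tendsto t atTop (𝓝 0) ∧ (∀ n, G n ∈ conePairs C) ∧
      (∀ n, (G n).1 *ᵥ e = e + t n • v) ∧
      (∀ n, ∀ h ∈ conePairs C, h.1 *ᵥ e = e + t n • v → ‖(G n).1 - 1‖ ≤ ‖h.1 - 1‖) ∧
      Tendsto G atTop (𝓝 (1, 1)) :=
    ⟨fun n => G₀ (φ n), fun n => 1 / ((φ n : ℝ) + 1), fun n => hτ0 _,
      hτ.comp hφ.tendsto_atTop, fun n => hG₀ _, fun n => hG₀x _, fun n => hG₀min _, hlim₀⟩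
  have hG1 : Tendsto (fun n => (G n).1) atTop (𝓝 1) := (continuous_fst.tendsto _).comp hlim
  -- Including `t n` in the scale bounds both `(G n - 1) / m n` and `t n / m n`, so both converge
  -- along a subsequence, and `X e = s v`.
  set m : ℕ → ℝ := fun n => ‖(G n).1 - 1‖ + t n with hm
  have hm0 : ∀ n, 0 < m n := fun n => add_pos_of_nonneg_of_pos (norm_nonneg _) (ht n)
  have hmlim : Tendsto m atTop (𝓝 0) := by
    have := ((hG1.sub_const 1).norm).add htlim
    simpa using this
  have hnorm : ∀ n, ‖(m n)⁻¹ • ((G n).1 - 1)‖ = 1 - t n / m n := fun n => by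
    rw [norm_smul, Real.norm_of_nonneg (inv_nonneg.2 (hm0 n).le), eq_sub_iff_add_eq,
      inv_mul_eq_div, ← add_div]
    exact div_self (hm0 n).ne'
  obtain ⟨⟨X, s⟩, -, ψ, hψ, hψlim⟩ := ((isCompact_closedBall (0 : Matrix ι ι ℝ) 1).prod
    (isCompact_Icc (a := (0 : ℝ)) (b := 1))).tendsto_subseq
    (x := fun n => ((m n)⁻¹ • ((G n).1 - 1), t n / m n)) fun n => by
      have h0 : 0 ≤ t n / m n := (div_pos (ht n) (hm0 n)).le
      have h1 : t n / m n ≤ 1 := by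
        rw [div_le_one (hm0 n)]
        exact le_add_of_nonneg_left (norm_nonneg _)
      refine ⟨?_, h0, h1⟩
      rw [mem_closedBall_zero_iff, hnorm]
      linarith
  have hXlim : Tendsto (fun n => (m (ψ n))⁻¹ • ((G (ψ n)).1 - 1)) atTop (𝓝 X) :=
    (continuous_fst.tendsto _).comp hψlim
  have hslim : Tendsto (fun n => t (ψ n) / m (ψ n)) atTop (𝓝 s) :=
    (continuous_snd.tendsto _).comp hψlim
  have hXd : IsConeDerivation C X := isConeDerivation_of_tendsto hsd (fun n => hm0 (ψ n))
    (fun n => hG (ψ n)) (hlim.comp hψ.tendsto_atTop) hXlim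
  have hXe : X *ᵥ e = s • v := by
    refine tendsto_nhds_unique (((continuous_id.matrix_mulVec continuous_const).tendsto X).comp
      hXlim) ((hslim.smul_const v).congr fun n => ?_)
    simp only [Function.comp_apply, id_eq]
    rw [Matrix.smul_mulVec, Matrix.sub_mulVec, hGx, Matrix.one_mulVec, add_sub_cancel_left,
      smul_smul, inv_mul_eq_div]
  by_cases hs : s = 0
  -- If `s = 0`, then `X e = 0`, so `G exp(-mX)` carries `e` to the same point. Its rescaled
  -- distance to `1` tends to `‖X - X‖ = 0`, while that of the nearest `G` tends to `1`.
  · exfalso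
    rw [hs, zero_smul] at hXe
    have hmψ : Tendsto (fun n => m (ψ n)) atTop (𝓝 0) := hmlim.comp hψ.tendsto_atTop
    have hle : ∀ n, ‖(m (ψ n))⁻¹ • ((G (ψ n)).1 - 1)‖ ≤
        ‖((m (ψ n))⁻¹ • ((G (ψ n)).1 - 1)) * exp (m (ψ n) • -X) +
          (m (ψ n))⁻¹ • (exp (m (ψ n) • -X) - 1)‖ := by
      intro n
      have hd : IsConeDerivation C (m (ψ n) • -X) := by
        simpa using hXd.smul (-(m (ψ n)))
      have h1 := hGmin (ψ n) _ (mul_mem_conePairs (hG (ψ n)) (hd.exp_mem_conePairs hsd)) (by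
        simp only
        rw [← Matrix.mulVec_mulVec, exp_mulVec_eq_self, hGx]
        rw [Matrix.smul_mulVec, Matrix.neg_mulVec, hXe, neg_zero, smul_zero])
      simp only at h1
      have h2 : ((m (ψ n))⁻¹ • ((G (ψ n)).1 - 1)) * exp (m (ψ n) • -X) +
          (m (ψ n))⁻¹ • (exp (m (ψ n) • -X) - 1) =
          (m (ψ n))⁻¹ • ((G (ψ n)).1 * exp (m (ψ n) • -X) - 1) := by
        rw [Matrix.smul_mul, sub_mul, one_mul]
        module
      rw [h2, norm_smul, norm_smul]
      exact mul_le_mul_of_nonneg_left h1 (norm_nonneg _)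
    have hexp : Tendsto (fun n => exp (m (ψ n) • -X)) atTop (𝓝 1) := by
      have h1 : Continuous fun r : ℝ => exp (r • -X) :=
        continuous_iff_continuousAt.2 fun r =>
          (hasDerivAt_exp_smul_const (𝕂 := ℝ) (-X) r).continuousAt
      have h2 := (h1.tendsto 0).comp hmψ
      rwa [zero_smul, exp_zero] at h2
    have hslope : Tendsto (fun n => (m (ψ n))⁻¹ • (exp (m (ψ n) • -X) - 1)) atTop (𝓝 (-X)) := by
      have h1 := hasDerivAt_iff_tendsto_slope_zero.1
        (hasDerivAt_exp_smul_const (𝕂 := ℝ) (-X) 0)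
      simp only [zero_smul, exp_zero, zero_add, one_mul] at h1
      exact h1.comp (tendsto_nhdsWithin_iff.2 ⟨hmψ, Eventually.of_forall fun n => (hm0 _).ne'⟩)
    have hR := ((hXlim.mul hexp).add hslope).norm
    rw [mul_one, add_neg_cancel, norm_zero] at hR
    have hL : Tendsto (fun n => ‖(m (ψ n))⁻¹ • ((G (ψ n)).1 - 1)‖) atTop (𝓝 1) := by
      simp_rw [hnorm]
      simpa [hs] using hslim.const_sub 1
    exact absurd (le_of_tendsto_of_tendsto' hL hR hle) (by norm_num)
  · exact ⟨s⁻¹ • X, hXd.smul _, by rw [Matrix.smul_mulVec, hXe, smul_smul, inv_mul_cancel₀ hs,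
      one_smul]⟩

/-- The Lie algebra of the automorphism group maps an interior point onto the whole space. -/
lemma exists_isConeDerivation_mulVec_eq (hC : IsSymmetricCone C) {e : ι → ℝ}
    (he : e ∈ interior C) (v : ι → ℝ) : ∃ X, IsConeDerivation C X ∧ X *ᵥ e = v := by
  have hsd := hC.selfDual
  obtain ⟨r, hr, hr0⟩ : ∃ r : ℝ, (1 / 2 : ℝ) • e + r • v ∈ C ∧ 0 < r := by
    have hcont : Tendsto (fun r : ℝ => (1 / 2 : ℝ) • e + r • v) (𝓝[>] 0)
        (𝓝 ((1 / 2 : ℝ) • e)) := by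
      have : Continuous fun r : ℝ => (1 / 2 : ℝ) • e + r • v := by fun_prop
      simpa using (this.tendsto 0).mono_left nhdsWithin_le_nhds
    exact ((hcont.eventually (mem_interior_iff_mem_nhds.1
      (smul_mem_interior_of_selfDual hsd he (a := 1 / 2) (by norm_num)))).and
      self_mem_nhdsWithin).exists
  obtain ⟨X, hX, hXe⟩ := exists_isConeDerivation_mulVec_eq_of_segment hC (v := r • v) he
    fun t h0 h1 => by
      have h2 := add_mem_of_selfDual hsd (smul_mem_of_selfDual hsd hr h0.le)
        (smul_mem_of_selfDual hsd (interior_subset he) (a := (1 - t) / 2) (by linarith))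
      convert h2 using 1
      module
  exact ⟨r⁻¹ • X, hX.smul _, by rw [Matrix.smul_mulVec, hXe, smul_smul,
    inv_mul_cancel₀ hr0.ne', one_smul]⟩

/-- At a point fixed by the orthogonal automorphisms, the symmetric elements of the Lie algebra
suffice. -/
lemma exists_isSymm_isConeDerivation_mulVec_eq (hC : IsSymmetricCone C) {e : ι → ℝ}
    (he : e ∈ interior C) (hfix : ∀ g : Matrix ι ι ℝ, (g, gᵀ) ∈ conePairs C → g *ᵥ e = e)
    (v : ι → ℝ) : ∃ X : Matrix ι ι ℝ, X.IsSymm ∧ IsConeDerivation C X ∧ X *ᵥ e = v := by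
  obtain ⟨X, hX, hXe⟩ := exists_isConeDerivation_mulVec_eq hC he v
  have hT : IsConeDerivation C (X - Xᵀ) := by
    simpa [sub_eq_add_neg] using hX.add (hX.transpose.smul (-1))
  -- `X - Xᵀ` is skew, so its exponentials are orthogonal automorphisms and fix `e`; differentiate
  -- at `0`.
  have hTe : (X - Xᵀ) *ᵥ e = 0 := by
    have hconst : ∀ t : ℝ, exp (t • (X - Xᵀ)) *ᵥ e = e := fun t => by
      refine hfix _ ?_
      have h1 := (hT.smul t).exp_mem_conePairs hC.selfDual
      have h2 : (exp (t • (X - Xᵀ)))ᵀ = exp (-(t • (X - Xᵀ))) := by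
        rw [← Matrix.exp_transpose]
        congr 1
        rw [Matrix.transpose_smul, Matrix.transpose_sub, Matrix.transpose_transpose]
        module
      rwa [h2]
    have h1 := hasDerivAt_exp_smul_mulVec (X - Xᵀ) e 0
    simp only [hconst] at h1
    exact h1.unique (hasDerivAt_const 0 e)
  refine ⟨(1 / 2 : ℝ) • (X + Xᵀ), ?_, (hX.add hX.transpose).smul _, ?_⟩
  · rw [Matrix.IsSymm, Matrix.transpose_smul, Matrix.transpose_add, Matrix.transpose_transpose,
      add_comm]
  · rw [Matrix.sub_mulVec, sub_eq_zero] at hTe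
    rw [Matrix.smul_mulVec, Matrix.add_mulVec, ← hTe, hXe]
    module

/-- The functional `g ↦ q · g e + e · g⁻¹ p` attains its minimum on the automorphism group. -/
lemma exists_min_conePairs (hC : dualCone C = C) {p q e : ι → ℝ} (hp : p ∈ interior C)
    (hq : q ∈ interior C) (he : e ∈ interior C) : ∃ g ∈ conePairs C, ∀ h ∈ conePairs C,
      q ⬝ᵥ (g.1 *ᵥ e) + e ⬝ᵥ (g.2 *ᵥ p) ≤ q ⬝ᵥ (h.1 *ᵥ e) + e ⬝ᵥ (h.2 *ᵥ p) := by
  set f : Matrix ι ι ℝ × Matrix ι ι ℝ → ℝ := fun g => q ⬝ᵥ (g.1 *ᵥ e) + e ⬝ᵥ (g.2 *ᵥ p)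
  have hfc : Continuous f :=
    (continuous_const.dotProduct (continuous_fst.matrix_mulVec continuous_const)).add
      (continuous_const.dotProduct (continuous_snd.matrix_mulVec continuous_const))
  have hle : ∀ g ∈ conePairs C, f g ≤ f (1, 1) → g ∈ conePairs C ∩
      {g | q ⬝ᵥ (g.1 *ᵥ e) ≤ f (1, 1) ∧ e ⬝ᵥ (g.2 *ᵥ p) ≤ f (1, 1)} := by
    intro g hg hgf
    have h1 := dotProduct_nonneg_of_selfDual hC (interior_subset hq)
      (hg.2.1 _ (interior_subset he))
    have h2 := dotProduct_nonneg_of_selfDual hC (interior_subset he)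
      (hg.2.2 _ (interior_subset hp))
    have h3 : f g = q ⬝ᵥ (g.1 *ᵥ e) + e ⬝ᵥ (g.2 *ᵥ p) := rfl
    exact ⟨hg, (le_add_of_nonneg_right h2).trans (h3 ▸ hgf),
      (le_add_of_nonneg_left h1).trans (h3 ▸ hgf)⟩
  obtain ⟨g, ⟨hg, -⟩, hmin⟩ := (isCompact_conePairs_inter hC he hq hp he (f (1, 1))
    (f (1, 1))).exists_isMinOn ⟨_, hle _ one_mem_conePairs le_rfl⟩ hfc.continuousOn
  refine ⟨g, hg, fun h hh => ?_⟩
  by_cases hfh : f h ≤ f (1, 1)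
  · exact hmin (hle h hh hfh)
  · exact le_trans (hmin (hle _ one_mem_conePairs le_rfl)) (not_le.1 hfh).le

/-- For symmetric `X`, the derivative along `g exp(tX)` is `(gᵀq - g⁻¹p) · Xe`; choose `X` so that
`Xe` is the bracket itself. -/
lemma transpose_mulVec_eq_of_forall_le (hC : IsSymmetricCone C) {p q e : ι → ℝ}
    (he : e ∈ interior C) (hfix : ∀ g : Matrix ι ι ℝ, (g, gᵀ) ∈ conePairs C → g *ᵥ e = e)
    {g : Matrix ι ι ℝ × Matrix ι ι ℝ} (hg : g ∈ conePairs C)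
    (hmin : ∀ h ∈ conePairs C,
      q ⬝ᵥ (g.1 *ᵥ e) + e ⬝ᵥ (g.2 *ᵥ p) ≤ q ⬝ᵥ (h.1 *ᵥ e) + e ⬝ᵥ (h.2 *ᵥ p)) :
    g.1ᵀ *ᵥ q = g.2 *ᵥ p := by
  have hsd := hC.selfDual
  rw [← sub_eq_zero]
  obtain ⟨X, hXs, hX, hXe⟩ :=
    exists_isSymm_isConeDerivation_mulVec_eq hC he hfix (g.1ᵀ *ᵥ q - g.2 *ᵥ p)
  have hd := (hasDerivAt_dotProduct_left (g.1ᵀ *ᵥ q) (hasDerivAt_exp_smul_mulVec X e 0)).add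
    (hasDerivAt_dotProduct_left e (hasDerivAt_exp_smul_mulVec (-X) (g.2 *ᵥ p) 0))
  have hloc : IsLocalMin ((fun t : ℝ => (g.1ᵀ *ᵥ q) ⬝ᵥ (exp (t • X) *ᵥ e)) +
      fun t : ℝ => e ⬝ᵥ (exp (t • -X) *ᵥ (g.2 *ᵥ p))) 0 := by
    refine Eventually.of_forall fun t => ?_
    have h1 := hmin _ (mul_mem_conePairs hg ((hX.smul t).exp_mem_conePairs hsd))
    simp only [Pi.add_apply, zero_smul, exp_zero, Matrix.one_mulVec]
    simp only [← Matrix.mulVec_mulVec] at h1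
    rwa [Matrix.dotProduct_mulVec q, Matrix.dotProduct_mulVec q, ← Matrix.mulVec_transpose,
      ← smul_neg] at h1
  have h0 := hloc.hasDerivAt_eq_zero hd
  simp only [zero_smul, exp_zero, Matrix.one_mulVec] at h0
  rw [Matrix.neg_mulVec, dotProduct_neg, Matrix.dotProduct_mulVec e, ← Matrix.mulVec_transpose,
    hXs, hXe, dotProduct_comm _ (g.2 *ᵥ p), ← sub_eq_add_neg, ← sub_dotProduct] at h0
  exact dotProduct_self_eq_zero.1 h0

/-- Any interior point of a symmetric cone is mapped to any other one by a positive definite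
automorphism. -/
lemma exists_posDef_automorphism (hC : IsSymmetricCone C) {p q : ι → ℝ}
    (hp : p ∈ interior C) (hq : q ∈ interior C) :
    ∃ g ∈ conePairs C, g.1.IsSymm ∧ (∀ x, x ≠ 0 → 0 < x ⬝ᵥ (g.1 *ᵥ x)) ∧ g.1 *ᵥ p = q := by
  have hsd := hC.selfDual
  obtain ⟨e, he, hfix⟩ := exists_mem_interior_fixed hsd
  obtain ⟨g, hg, hmin⟩ := exists_min_conePairs hsd hp hq he
  have hcrit := transpose_mulVec_eq_of_forall_le hC he hfix hg hmin
  -- `P = g⁻ᵀg⁻¹`, so `Pp = g⁻ᵀ(gᵀq) = q`.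
  have hP := mul_mem_conePairs (transpose_mem_conePairs hsd (swap_mem_conePairs hg))
    (swap_mem_conePairs hg)
  refine ⟨_, hP, ?_, ?_, ?_⟩
  · simp [Matrix.IsSymm]
  · intro x hx
    simp only
    rw [← Matrix.mulVec_mulVec, Matrix.dotProduct_mulVec, Matrix.vecMul_transpose]
    refine dotProduct_self_pos fun h => hx ?_
    rw [← Matrix.one_mulVec x, ← show g.1 * g.2 = 1 from hg.1, ← Matrix.mulVec_mulVec, h,
      Matrix.mulVec_zero]
  · simp only
    rw [← Matrix.mulVec_mulVec, ← hcrit, Matrix.mulVec_mulVec, ← Matrix.transpose_mul, hg.1,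
      Matrix.transpose_one, Matrix.one_mulVec]

end Tangent

/-! ### Direct sums of self-dual cones. -/

section DirectSum

variable {ι κ : Type*} {C₁ : Set (ι → ℝ)} {C₂ : Set (κ → ℝ)}

lemma elim_mem_coneSum {x : ι → ℝ} {y : κ → ℝ} :
    Sum.elim x y ∈ coneSum C₁ C₂ ↔ x ∈ C₁ ∧ y ∈ C₂ := Iff.rfl

variable [Fintype ι] [Fintype κ]

lemma dualCone_coneSum (h₁ : dualCone C₁ = C₁) (h₂ : dualCone C₂ = C₂) :
    dualCone (coneSum C₁ C₂) = coneSum C₁ C₂ := by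
  ext y
  obtain ⟨y₁, y₂, rfl⟩ : ∃ y₁ y₂, y = Sum.elim y₁ y₂ :=
    ⟨y ∘ Sum.inl, y ∘ Sum.inr, (Sum.elim_comp_inl_inr y).symm⟩
  rw [elim_mem_coneSum]
  constructor
  · refine fun h => ⟨(mem_iff_of_selfDual h₁).2 fun x hx => ?_,
      (mem_iff_of_selfDual h₂).2 fun x hx => ?_⟩
    · simpa using h (Sum.elim x 0) (elim_mem_coneSum.2 ⟨hx, zero_mem_of_selfDual h₂⟩)
    · simpa using h (Sum.elim 0 x) (elim_mem_coneSum.2 ⟨zero_mem_of_selfDual h₁, hx⟩)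
  · rintro ⟨hy₁, hy₂⟩ x ⟨hx₁, hx₂⟩
    obtain ⟨x₁, x₂, rfl⟩ : ∃ x₁ x₂, x = Sum.elim x₁ x₂ :=
      ⟨x ∘ Sum.inl, x ∘ Sum.inr, (Sum.elim_comp_inl_inr x).symm⟩
    rw [sumElim_dotProduct_sumElim]
    exact add_nonneg (dotProduct_nonneg_of_selfDual h₁ hy₁ hx₁)
      (dotProduct_nonneg_of_selfDual h₂ hy₂ hx₂)

lemma mem_interior_of_elim_mem_interior (h₁ : dualCone C₁ = C₁) (h₂ : dualCone C₂ = C₂)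
    {x : ι → ℝ} {y : κ → ℝ} (h : Sum.elim x y ∈ interior (coneSum C₁ C₂)) :
    x ∈ interior C₁ ∧ y ∈ interior C₂ := by
  rw [mem_interior_iff_of_selfDual (dualCone_coneSum h₁ h₂)] at h
  rw [mem_interior_iff_of_selfDual h₁, mem_interior_iff_of_selfDual h₂]
  refine ⟨fun u hu hu0 => ?_, fun u hu hu0 => ?_⟩
  · simpa using h (Sum.elim u 0) (elim_mem_coneSum.2 ⟨hu, zero_mem_of_selfDual h₂⟩)
      fun h0 => hu0 (funext fun i => congrFun h0 (Sum.inl i))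
  · simpa using h (Sum.elim 0 u) (elim_mem_coneSum.2 ⟨zero_mem_of_selfDual h₁, hu⟩)
      fun h0 => hu0 (funext fun i => congrFun h0 (Sum.inr i))

lemma fromBlocks_diagonal_mulVec_elim (P : Matrix ι ι ℝ) (Q : Matrix κ κ ℝ) (x : ι → ℝ)
    (y : κ → ℝ) :
    Matrix.fromBlocks P 0 0 Q *ᵥ Sum.elim x y = Sum.elim (P *ᵥ x) (Q *ᵥ y) := by
  simp [Matrix.fromBlocks_mulVec]

lemma fromBlocks_mem_conePairs [DecidableEq ι] [DecidableEq κ]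
    {g : Matrix ι ι ℝ × Matrix ι ι ℝ} {h : Matrix κ κ ℝ × Matrix κ κ ℝ}
    (hg : g ∈ conePairs C₁) (hh : h ∈ conePairs C₂) :
    (Matrix.fromBlocks g.1 0 0 h.1, Matrix.fromBlocks g.2 0 0 h.2) ∈
      conePairs (coneSum C₁ C₂) := by
  refine ⟨by simp [Matrix.fromBlocks_multiply, hg.1, hh.1], fun x hx => ?_, fun x hx => ?_⟩ <;>
  · obtain ⟨x₁, x₂, rfl⟩ : ∃ x₁ x₂, x = Sum.elim x₁ x₂ :=
      ⟨x ∘ Sum.inl, x ∘ Sum.inr, (Sum.elim_comp_inl_inr x).symm⟩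
    simp only [fromBlocks_diagonal_mulVec_elim, elim_mem_coneSum] at hx ⊢
    first
    | exact ⟨hg.2.1 _ hx.1, hh.2.1 _ hx.2⟩
    | exact ⟨hg.2.2 _ hx.1, hh.2.2 _ hx.2⟩

end DirectSum

/-! ### From eigenvalues to the Lyapunov inequality. -/

section Lyapunov

variable {ι : Type*} [Fintype ι] {C : Set (ι → ℝ)}

lemma IsHurwitz.det_smul_one_sub_ne_zero [DecidableEq ι] {A : Matrix ι ι ℝ} (hA : IsHurwitz A)
    {s : ℝ} (hs : 0 ≤ s) : (s • (1 : Matrix ι ι ℝ) - A).det ≠ 0 := by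
  intro h0
  have hmem : (s : ℂ) ∈ spectrum ℂ (A.map Complex.ofReal) := by
    rw [spectrum.mem_iff, Matrix.isUnit_iff_isUnit_det]
    have h1 : algebraMap ℂ (Matrix ι ι ℂ) (s : ℂ) - A.map Complex.ofReal =
        (s • (1 : Matrix ι ι ℝ) - A).map Complex.ofRealHom := by
      ext i j
      by_cases h : i = j <;> simp [Matrix.algebraMap_matrix_apply, h]
    rw [h1, ← RingHom.mapMatrix_apply, ← RingHom.map_det, h0]
    simp
  have := hA _ hmem
  rw [Complex.ofReal_re] at this
  linarith

/-- The quotient `x · Sx / x · Px` attains its maximum `l` at some `z`. Then `lP - S` is positive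
semidefinite and its form vanishes at `z`, so `Sz = lPz`: the maximum is a generalized eigenvalue,
hence negative. -/
lemma dotProduct_mulVec_neg_of_pencil {P S : Matrix ι ι ℝ} (hPs : P.IsSymm)
    (hSs : S.IsSymm) (hP : ∀ x, x ≠ 0 → 0 < x ⬝ᵥ (P *ᵥ x))
    (h : ∀ x, x ≠ 0 → ∀ l : ℝ, S *ᵥ x = l • (P *ᵥ x) → l < 0) {x : ι → ℝ} (hx : x ≠ 0) :
    x ⬝ᵥ (S *ᵥ x) < 0 := by
  have hcont : ∀ M : Matrix ι ι ℝ, Continuous fun x : ι → ℝ => x ⬝ᵥ (M *ᵥ x) := fun M =>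
    continuous_id.dotProduct (continuous_const.matrix_mulVec continuous_id)
  have hne : (Metric.sphere (0 : ι → ℝ) 1).Nonempty :=
    ⟨‖x‖⁻¹ • x, by simp [norm_smul, hx]⟩
  have hsph : ∀ u ∈ Metric.sphere (0 : ι → ℝ) 1, u ≠ 0 := by
    rintro _ hu rfl
    simp at hu
  obtain ⟨z, hz, hmax⟩ := (isCompact_sphere (0 : ι → ℝ) 1).exists_isMaxOn hne
    (f := fun u => (u ⬝ᵥ (S *ᵥ u)) / (u ⬝ᵥ (P *ᵥ u)))
    ((hcont S).continuousOn.div (hcont P).continuousOn fun u hu => (hP u (hsph u hu)).ne')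
  set l := (z ⬝ᵥ (S *ᵥ z)) / (z ⬝ᵥ (P *ᵥ z)) with hl
  have hzS : z ⬝ᵥ (S *ᵥ z) = l * (z ⬝ᵥ (P *ᵥ z)) := by
    rw [hl, div_mul_cancel₀ _ (hP z (hsph z hz)).ne']
  have hle : ∀ u, u ⬝ᵥ (S *ᵥ u) ≤ l * (u ⬝ᵥ (P *ᵥ u)) := by
    intro u
    by_cases hu : u = 0
    · simp [hu]
    have hn : 0 < ‖u‖ := norm_pos_iff.2 hu
    have h1 : (‖u‖⁻¹ • u ⬝ᵥ (S *ᵥ (‖u‖⁻¹ • u))) / (‖u‖⁻¹ • u ⬝ᵥ (P *ᵥ (‖u‖⁻¹ • u))) ≤ l :=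
      hmax (by simp [norm_smul, hn.ne'])
    simp only [Matrix.mulVec_smul, dotProduct_smul, smul_dotProduct, smul_eq_mul] at h1
    rw [mul_div_mul_left _ _ (inv_ne_zero hn.ne'), mul_div_mul_left _ _ (inv_ne_zero hn.ne'),
      div_le_iff₀ (hP u hu)] at h1
    exact h1
  have hQ : (l • P - S).PosSemidef := by
    refine Matrix.PosSemidef.of_dotProduct_mulVec_nonneg ?_ fun u => ?_
    · rw [Matrix.IsHermitian, Matrix.conjTranspose_eq_transpose_of_trivial,
        Matrix.transpose_sub, Matrix.transpose_smul, hPs, hSs]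
    · rw [star_trivial, Matrix.sub_mulVec, Matrix.smul_mulVec, dotProduct_sub, dotProduct_smul,
        smul_eq_mul, sub_nonneg]
      exact hle u
  have hzero : (l • P - S) *ᵥ z = 0 := by
    rw [← hQ.dotProduct_mulVec_zero_iff, star_trivial, Matrix.sub_mulVec, Matrix.smul_mulVec,
      dotProduct_sub, dotProduct_smul, smul_eq_mul, hzS, sub_self]
  rw [Matrix.sub_mulVec, Matrix.smul_mulVec, sub_eq_zero] at hzero
  exact (hle x).trans_lt (mul_neg_of_neg_of_pos (h z (hsph z hz) l hzero.symm) (hP x hx))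

/-- If a positive definite automorphism `P` of the cone maps `p` to `q`, where `-A p` and `-Aᵀ q`
are interior points, then `P` solves the Lyapunov inequality `P A + Aᵀ P < 0`. -/
lemma IsCrossNonneg.lyapunov_inequality [DecidableEq ι] (hC : dualCone C = C)
    {A : Matrix ι ι ℝ} (hA : IsCrossNonneg C A) {g : Matrix ι ι ℝ × Matrix ι ι ℝ}
    (hg : g ∈ conePairs C) (hs : g.1.IsSymm) (hpos : ∀ x, x ≠ 0 → 0 < x ⬝ᵥ (g.1 *ᵥ x))
    {p : ι → ℝ} (hp : p ∈ interior C) (hAp : -(A *ᵥ p) ∈ interior C)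
    (hAq : -(Aᵀ *ᵥ (g.1 *ᵥ p)) ∈ C) {x : ι → ℝ} (hx : x ≠ 0) :
    x ⬝ᵥ ((g.1 * A + Aᵀ * g.1) *ᵥ x) < 0 := by
  -- Conjugation preserves cross-nonnegativity: if `y ⊥ x` in `C`, then `P⁻ᵀy ⊥ Px` in `C`.
  have hB : IsCrossNonneg C (A + g.2 * (Aᵀ * g.1)) := by
    refine hA.add fun x hx y hy h => ?_
    rw [← Matrix.mulVec_mulVec, ← Matrix.mulVec_mulVec, Matrix.dotProduct_mulVec,
      ← Matrix.mulVec_transpose]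
    refine hA.transpose _ (hg.2.1 x hx) _ (transpose_mulVec_mem hC hg.2.2 hy) ?_
    rw [Matrix.mulVec_transpose, ← Matrix.dotProduct_mulVec, Matrix.mulVec_mulVec,
      mul_eq_one_comm.1 hg.1, Matrix.one_mulVec, h]
  have hBp : -((A + g.2 * (Aᵀ * g.1)) *ᵥ p) ∈ interior C := by
    have := add_mem_interior_of_selfDual hC hAp (hg.2.2 _ hAq)
    rwa [Matrix.mulVec_neg, Matrix.mulVec_mulVec, Matrix.mulVec_mulVec, ← neg_add,
      ← Matrix.add_mulVec, Matrix.mul_assoc] at this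
  refine dotProduct_mulVec_neg_of_pencil hs ?_ hpos (fun z hz l hl => ?_) hx
  · rw [Matrix.IsSymm, Matrix.transpose_add, Matrix.transpose_mul, Matrix.transpose_mul,
      Matrix.transpose_transpose, hs, add_comm]
  · refine hB.eigenvalue_neg hC hp hBp hz (l := l) ?_
    have h1 : g.2 *ᵥ ((g.1 * A + Aᵀ * g.1) *ᵥ z) = g.2 *ᵥ (l • (g.1 *ᵥ z)) := by rw [hl]
    rwa [Matrix.mulVec_smul, Matrix.mulVec_mulVec, Matrix.mulVec_mulVec, Matrix.mul_add,
      ← Matrix.mul_assoc, mul_eq_one_comm.1 hg.1, Matrix.one_mul, Matrix.one_mulVec] at h1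

/-- Along the line `x + t A x` the form is a quadratic polynomial in `t`, whose linear coefficient
is the directional derivative. -/
lemma isLyapunovFunction_quadratic {A P : Matrix ι ι ℝ} (hpos : ∀ x, x ≠ 0 → 0 < x ⬝ᵥ (P *ᵥ x))
    (hneg : ∀ x, x ≠ 0 → x ⬝ᵥ ((P * A + Aᵀ * P) *ᵥ x) < 0) :
    IsLyapunovFunction A (fun x => x ⬝ᵥ (P *ᵥ x)) := by
  have hcd : ContDiff ℝ 1 fun x : ι → ℝ => x ⬝ᵥ (P *ᵥ x) := by
    simp only [dotProduct, Matrix.mulVec]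
    fun_prop
  refine ⟨hcd, by simp, hpos, fun x hx => ?_⟩
  have hline : HasDerivAt (fun t : ℝ => x + t • (A *ᵥ x)) (A *ᵥ x) 0 := by
    simpa using ((hasDerivAt_id (0 : ℝ)).smul_const (A *ᵥ x)).const_add x
  have h1 : HasDerivAt (fun t : ℝ => (x + t • (A *ᵥ x)) ⬝ᵥ (P *ᵥ (x + t • (A *ᵥ x))))
      (fderiv ℝ (fun x : ι → ℝ => x ⬝ᵥ (P *ᵥ x)) x (A *ᵥ x)) 0 := by
    have hf : HasFDerivAt (fun x : ι → ℝ => x ⬝ᵥ (P *ᵥ x))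
        (fderiv ℝ (fun x : ι → ℝ => x ⬝ᵥ (P *ᵥ x)) x) (x + (0 : ℝ) • (A *ᵥ x)) := by
      rw [zero_smul, add_zero]
      exact (hcd.differentiable one_ne_zero x).hasFDerivAt
    exact HasFDerivAt.comp_hasDerivAt (f := fun t : ℝ => x + t • (A *ᵥ x)) (0 : ℝ) hf hline
  have h2 : HasDerivAt (fun t : ℝ => (x + t • (A *ᵥ x)) ⬝ᵥ (P *ᵥ (x + t • (A *ᵥ x))))
      (x ⬝ᵥ ((P * A + Aᵀ * P) *ᵥ x)) 0 := by
    have hexp : ∀ t : ℝ, (x + t • (A *ᵥ x)) ⬝ᵥ (P *ᵥ (x + t • (A *ᵥ x))) =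
        x ⬝ᵥ (P *ᵥ x) + t * (x ⬝ᵥ ((P * A + Aᵀ * P) *ᵥ x)) +
          t ^ 2 * ((A *ᵥ x) ⬝ᵥ (P *ᵥ (A *ᵥ x))) := by
      intro t
      have h3 : x ⬝ᵥ ((P * A + Aᵀ * P) *ᵥ x) =
          x ⬝ᵥ (P *ᵥ (A *ᵥ x)) + (A *ᵥ x) ⬝ᵥ (P *ᵥ x) := by
        rw [Matrix.add_mulVec, dotProduct_add, ← Matrix.mulVec_mulVec, ← Matrix.mulVec_mulVec,
          Matrix.dotProduct_mulVec x Aᵀ, Matrix.vecMul_transpose]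
      rw [h3]
      simp only [Matrix.mulVec_add, Matrix.mulVec_smul, dotProduct_add, add_dotProduct,
        dotProduct_smul, smul_dotProduct, smul_eq_mul]
      ring
    simp_rw [hexp]
    have h4 : ∀ a b c : ℝ, HasDerivAt (fun t : ℝ => a + t * b + t ^ 2 * c) b 0 := fun a b c => by
      simpa using (((hasDerivAt_id' (0 : ℝ)).mul_const b).const_add a).fun_add
        (((hasDerivAt_id' (0 : ℝ)).fun_pow 2).mul_const c)
    exact h4 _ _ _
  rw [h1.unique h2]
  exact hneg x hx

end Lyapunov

end ConeLyapunov

theorem mainTheorem6 (n₁ n₂ : ℕ) (C₁ : Set (Fin n₁ → ℝ)) (C₂ : Set (Fin n₂ → ℝ))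
    (hC₁ : IsSymmetricCone C₁) (hC₂ : IsSymmetricCone C₂)
    (A : Matrix (Fin n₁ ⊕ Fin n₂) (Fin n₁ ⊕ Fin n₂) ℝ)
    (hA : A ∈ expNonneg (coneSum C₁ C₂)) (hHurwitz : IsHurwitz A) :
    ∃ (P₁ : Matrix (Fin n₁) (Fin n₁) ℝ) (P₂ : Matrix (Fin n₂) (Fin n₂) ℝ),
      P₁.IsSymm ∧ P₂.IsSymm ∧ P₁ ∈ coneAut C₁ ∧ P₂ ∈ coneAut C₂ ∧
      IsLyapunovFunction A (fun x => x ⬝ᵥ (Matrix.fromBlocks P₁ 0 0 P₂ *ᵥ x)) := by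
  have h₁ := hC₁.selfDual
  have h₂ := hC₂.selfDual
  have hC := dualCone_coneSum h₁ h₂
  have hAc := isCrossNonneg_of_mem_expNonneg hC hA
  have hdet : ∀ s : ℝ, 0 ≤ s → (s • (1 : Matrix (Fin n₁ ⊕ Fin n₂) _ ℝ) - A).det ≠ 0 :=
    fun s hs => hHurwitz.det_smul_one_sub_ne_zero hs
  have hdet' : ∀ s : ℝ, 0 ≤ s → (s • (1 : Matrix (Fin n₁ ⊕ Fin n₂) _ ℝ) - Aᵀ).det ≠ 0 :=
    fun s hs => by
      have := hdet s hs
      rwa [← Matrix.det_transpose, Matrix.transpose_sub, Matrix.transpose_smul,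
        Matrix.transpose_one] at this
  obtain ⟨e, he⟩ := interior_nonempty_of_selfDual hC
  obtain ⟨p, hp, hAp⟩ := hAc.exists_mulVec_eq_neg hC hdet he
  obtain ⟨q, hq, hAq⟩ := hAc.transpose.exists_mulVec_eq_neg hC hdet' he
  obtain ⟨p₁, p₂, rfl⟩ : ∃ p₁ p₂, p = Sum.elim p₁ p₂ :=
    ⟨p ∘ Sum.inl, p ∘ Sum.inr, (Sum.elim_comp_inl_inr p).symm⟩
  obtain ⟨q₁, q₂, rfl⟩ : ∃ q₁ q₂, q = Sum.elim q₁ q₂ :=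
    ⟨q ∘ Sum.inl, q ∘ Sum.inr, (Sum.elim_comp_inl_inr q).symm⟩
  obtain ⟨hp₁, hp₂⟩ := mem_interior_of_elim_mem_interior h₁ h₂ hp
  obtain ⟨hq₁, hq₂⟩ := mem_interior_of_elim_mem_interior h₁ h₂ hq
  -- Only here is homogeneity used, one summand at a time; this is what makes `P` block diagonal.
  obtain ⟨g₁, hg₁, hs₁, hpos₁, rfl⟩ := exists_posDef_automorphism hC₁ hp₁ hq₁
  obtain ⟨g₂, hg₂, hs₂, hpos₂, rfl⟩ := exists_posDef_automorphism hC₂ hp₂ hq₂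
  refine ⟨g₁.1, g₂.1, hs₁, hs₂, mem_coneAut_of_mem_conePairs hg₁,
    mem_coneAut_of_mem_conePairs hg₂, ?_⟩
  have hpos : ∀ x, x ≠ 0 → 0 < x ⬝ᵥ (Matrix.fromBlocks g₁.1 0 0 g₂.1 *ᵥ x) := by
    intro x hx
    obtain ⟨x₁, x₂, rfl⟩ : ∃ x₁ x₂, x = Sum.elim x₁ x₂ :=
      ⟨x ∘ Sum.inl, x ∘ Sum.inr, (Sum.elim_comp_inl_inr x).symm⟩
    rw [fromBlocks_diagonal_mulVec_elim, sumElim_dotProduct_sumElim]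
    have hn₁ : 0 ≤ x₁ ⬝ᵥ (g₁.1 *ᵥ x₁) := by
      by_cases h : x₁ = 0
      · simp [h]
      · exact (hpos₁ x₁ h).le
    by_cases h : x₂ = 0
    · have : x₁ ≠ 0 := by
        rintro rfl
        refine hx ?_
        rw [h]
        exact Sum.elim_zero_zero
      exact add_pos_of_pos_of_nonneg (hpos₁ x₁ this) (by simp [h])
    · exact add_pos_of_nonneg_of_pos hn₁ (hpos₂ x₂ h)
  refine isLyapunovFunction_quadratic hpos fun x hx => ?_
  refine hAc.lyapunov_inequality hC (fromBlocks_mem_conePairs hg₁ hg₂)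
    (Matrix.IsSymm.fromBlocks hs₁ (by simp) hs₂) hpos hp (by rwa [hAp, neg_neg]) ?_ hx
  simp only
  rw [fromBlocks_diagonal_mulVec_elim, hAq, neg_neg]
  exact interior_subset he
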